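/- **Conventions.** A simplicial complex is *flag* if every nonempty finite set of vertices pairwise joined by edges spans a simplex. For $k\ge 4$ it is *$k$-large* if it is flag and no full subcomplex of it is a $j$-cycle (a triangulated circle with $j$ vertices) with $4\le j<k$; it is *locally $k$-large* if the links of all its nonempty simplices are $k$-large. For $k\ge 6$ a complex is *$k$-systolic* if it is flag, simply connected and locally $k$-large, and a group is *$k$-systolic* if it acts geometrically (properly and cocompactly) by simplicial automorphisms on a $k$-systolic complex. The nerve of a Coxeter system $(W,S)$ is the complex of nonempty subsets $T\subseteq S$ for which the subgroup $W_T=\langle T\rangle$ is finite. For a right-angled system, the Davis complex $\Sigma=\Sigma(W,S)$ is the cubical complex with vertex set $W$ whose cubes have as vertex sets the cosets $wW_T$ with $W_T$ finite. The *thickening* $Th(Y)$ of a cubical complex $Y$ has the same vertices as $Y$, and vertices span a simplex iff they lie in a common cube of $Y$. **The basic construction.** Start with a finite complex $X_0$ and perform finitely many (possibly zero) steps. A step takes the current complex $X$, forms the right-angled Coxeter system $(W,S)$ with nerve $X$ and its Davis complex $\Sigma$, chooses a torsion-free subgroup $H<W$ of finite index, and replaces $X$ by $X'=Th(H\backslash\Sigma)$.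 The *minimal displacement* of $H$ on the $1$-skeleton $Th(\Sigma)^{(1)}$ is $$\inf\{\,d(v,hv)\;:\; v \text{ a vertex of } Th(\Sigma),\ h\in H,\ h\neq 1\,\}$$ (with $\inf\emptyset=\infty$), where $d$ is the path metric of $Th(\Sigma)^{(1)}$ with edges of length $1$. **Proposition (Systolic groups).** Let $k\ge 6$ and let $X_0$ be a finite $k$-large simplicial complex. Let $X$ be obtained from $X_0$ by the basic construction, where at every step the subgroup $H$ is chosen so that its minimal displacement on $Th(\Sigma)^{(1)}$ is at least $k$. Then $X$ is $k$-large; consequently there is exactly one right-angled Coxeter system with generating set the vertices of $X$ and nerve $X$, and its Coxeter group $W$ is $k$-systolic. -/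

import Mathlib

universe u

/-! ### Simplicial complexes -/

namespace PreAbstractSimplicialComplex

variable {V : Type u}

open Classical in
/-- The `1`-skeleton: distinct vertices are adjacent iff they span an edge. -/
def oneSkeleton (K : PreAbstractSimplicialComplex V) : SimpleGraph V where
  Adj u v := u ≠ v ∧ ({u, v} : Finset V) ∈ K
  symm := ⟨fun u v h => ⟨h.1.symm, by rw [Finset.pair_comm]; exact h.2⟩⟩
  loopless := ⟨fun _ h => h.1 rfl⟩

/-- `K` is flag: every finite set of vertices that are pairwise joined by edges is a simplex. -/
def IsFlag (K : PreAbstractSimplicialComplex V) : Prop :=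
  ∀ s : Finset V, s.Nonempty → (∀ v ∈ s, {v} ∈ K) →
    (∀ u ∈ s, ∀ v ∈ s, u ≠ v → K.oneSkeleton.Adj u v) → s ∈ K

open Classical in
/-- The distinct vertices `c 0, …, c (n-1)` span a full subcomplex of `K` that is an `n`-cycle:
the simplices of `K` on these vertices are exactly the vertices `c i` and the edges
`{c i, c (i+1)}`, with indices modulo `n`. -/
def IsFullCycle (K : PreAbstractSimplicialComplex V) (n : ℕ) (c : ZMod n → V) : Prop :=
  Function.Injective c ∧
    ∀ s : Finset V, (s : Set V) ⊆ Set.range c →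
      (s ∈ K ↔ (∃ i, s = {c i}) ∨ ∃ i, s = {c i, c (i + 1)})

/-- `K` is `k`-large: it is flag and no full subcomplex is an `n`-cycle with `4 ≤ n < k`. -/
def IsLarge (k : ℕ) (K : PreAbstractSimplicialComplex V) : Prop :=
  K.IsFlag ∧ ∀ n : ℕ, 4 ≤ n → n < k → ∀ c : ZMod n → V, ¬ K.IsFullCycle n c

open Classical in
/-- The link of `σ`: the simplices `τ` disjoint from `σ` such that `τ ∪ σ` is a simplex. -/
def link (K : PreAbstractSimplicialComplex V) (σ : Finset V) : PreAbstractSimplicialComplex V where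
  faces := {τ | τ ∈ K ∧ Disjoint τ σ ∧ τ ∪ σ ∈ K}
  isRelLowerSet_faces := by
    rintro τ ⟨h1, h2, h3⟩
    refine ⟨(K.isRelLowerSet_faces h1).1, fun ρ hρ hne => ⟨?_, ?_, ?_⟩⟩
    · exact (K.isRelLowerSet_faces h1).2 hρ hne
    · exact Disjoint.mono_left hρ h2
    · exact (K.isRelLowerSet_faces h3).2 (Finset.union_subset_union hρ le_rfl)
        (hne.mono Finset.subset_union_left)

/-- `K` is locally `k`-large: the links of all its (nonempty) simplices are `k`-large. -/
def IsLocallyLarge (k : ℕ) (K : PreAbstractSimplicialComplex V) : Prop :=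
  ∀ σ ∈ K, (K.link σ).IsLarge k

/-- The geometric realization of `K`, in barycentric coordinates: the families `x ≥ 0` with total
sum `1` that are supported on a simplex of `K`. As a subset of `V → ℝ` it carries the topology of
the barycentric metric (for probability vectors of finite support, convergence of each coordinate
is `ℓ¹`-convergence); on locally finite complexes, in particular on every complex with a geometric
group action in the sense below, this is also the weak topology. -/
def realization (K : PreAbstractSimplicialComplex V) : Set (V → ℝ) :=
  {x | (∀ v, 0 ≤ x v) ∧ ∃ s ∈ K, (∀ v, v ∉ s → x v = 0) ∧ ∑ v ∈ s, x v = 1}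

/-- `K` is `k`-systolic (`k ≥ 6`): flag, simply connected and locally `k`-large. -/
structure IsSystolic (k : ℕ) (K : PreAbstractSimplicialComplex V) : Prop where
  flag : K.IsFlag
  simplyConnected : SimplyConnectedSpace K.realization
  locallyLarge : K.IsLocallyLarge k

end PreAbstractSimplicialComplex

/-! ### Geometric actions and `k`-systolic groups -/

/-- The action of `G` on the vertices of `K` is a geometric action by simplicial automorphisms:
it maps simplices to simplices, it is proper (stabilizers of simplices are finite), and it is
cocompact (there are finitely many orbits of simplices). -/
structure ActsGeometrically (G : Type u) [Group G] {V : Type u} [MulAction G V]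
    (K : AbstractSimplicialComplex V) : Prop where
  simplicial : ∀ (g : G), ∀ s ∈ K, s.map (MulAction.toPerm g).toEmbedding ∈ K
  proper : ∀ s ∈ K, {g : G | s.map (MulAction.toPerm g).toEmbedding = s}.Finite
  cocompact : ∃ F : Set (Finset V), F.Finite ∧
    ∀ s ∈ K, ∃ t ∈ F, ∃ g : G, t.map (MulAction.toPerm g).toEmbedding = s

/-- A group is `k`-systolic if it acts geometrically by simplicial automorphisms on a `k`-systolic
simplicial complex. -/
def IsSystolicGroup (k : ℕ) (G : Type u) [Group G] : Prop :=
  ∃ (V : Type u) (_ : MulAction G V) (K : AbstractSimplicialComplex V),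
    K.toPreAbstractSimplicialComplex.IsSystolic k ∧ ActsGeometrically G K

/-! ### Coxeter groups, nerves and Davis complexes -/

namespace CoxeterMatrix

variable {S : Type u} (M : CoxeterMatrix S)

/-- All `m_{st}` lie in `{1, 2, ∞}`; the value `∞` is encoded by `0`. -/
def IsRightAngled : Prop :=
  ∀ s t, M s t = 1 ∨ M s t = 2 ∨ M s t = 0

/-- The special subgroup `W_T`, generated by `T ⊆ S`. -/
def specialSubgroup (T : Finset S) : Subgroup M.Group :=
  Subgroup.closure (M.simple '' (T : Set S))

/-- `T` is spherical: `W_T` is finite. -/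
def IsSpherical (T : Finset S) : Prop :=
  (M.specialSubgroup T : Set M.Group).Finite

theorem isSpherical_empty : M.IsSpherical ∅ := by
  simp [IsSpherical, specialSubgroup]

theorem isSpherical_singleton (s : S) : M.IsSpherical {s} := by
  have h : IsOfFinOrder (M.simple s) :=
    isOfFinOrder_iff_pow_eq_one.2 ⟨2, two_pos, M.toCoxeterSystem.simple_sq s⟩
  have h2 : M.specialSubgroup {s} = Subgroup.zpowers (M.simple s) := by
    simp [specialSubgroup, Subgroup.zpowers_eq_closure]
  rw [IsSpherical, h2]
  exact h.finite_zpowers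

/-- The nerve of the Coxeter system `(W, S)`: the complex of nonempty spherical subsets of `S`. -/
def nerve : AbstractSimplicialComplex S where
  faces := {T | T.Nonempty ∧ M.IsSpherical T}
  isRelLowerSet_faces := by
    rintro T ⟨h1, h2⟩
    refine ⟨h1, fun R hR hne => ⟨hne, Set.Finite.subset h2 ?_⟩⟩
    exact Subgroup.closure_mono (Set.image_mono (Finset.coe_subset.2 hR))
  singleton_mem s := ⟨Finset.singleton_nonempty s, M.isSpherical_singleton s⟩

/-- The cubes of the Davis complex `Σ(W, S)` of a right-angled system, given by their vertex sets:
the vertices are the elements of `W`, and the cubes are the cosets `w W_T` with `T` spherical. -/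
def davisCubes : Set (Set M.Group) :=
  {c | ∃ (w : M.Group) (T : Finset S), M.IsSpherical T ∧
    c = (fun g => w * g) '' (M.specialSubgroup T : Set M.Group)}

theorem exists_mem_davisCubes (w : M.Group) : ∃ c ∈ M.davisCubes, w ∈ c :=
  ⟨_, ⟨w, ∅, M.isSpherical_empty, rfl⟩, 1, Subgroup.one_mem _, mul_one w⟩

end CoxeterMatrix

/-! ### Thickenings and the basic construction -/

/-- The thickening of a cubical complex with vertex set `V`, whose cubes have the members of `C`
as their vertex sets: its vertices are those of the cubical complex, and vertices span a simplex
iff they are contained in a common cube. -/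
def thickening {V : Type u} (C : Set (Set V)) (hC : ∀ v, ∃ c ∈ C, v ∈ c) :
    AbstractSimplicialComplex V where
  faces := {s | s.Nonempty ∧ ∃ c ∈ C, (s : Set V) ⊆ c}
  isRelLowerSet_faces := by
    rintro s ⟨h1, c, hc, hsc⟩
    exact ⟨h1, fun t ht hne => ⟨hne, c, hc, (Finset.coe_subset.2 ht).trans hsc⟩⟩
  singleton_mem v := by
    obtain ⟨c, hc, hv⟩ := hC v
    exact ⟨Finset.singleton_nonempty v, c, hc, by simpa using hv⟩

namespace CoxeterMatrix

variable {S : Type u} (M : CoxeterMatrix S)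

/-- `Th(Σ)`, the thickening of the Davis complex. -/
def davisThickening : AbstractSimplicialComplex M.Group :=
  thickening M.davisCubes M.exists_mem_davisCubes

/-- The minimal displacement of `H ≤ W` acting by left multiplication on `Th(Σ)`: the infimum of
`d(v, hv)` over all vertices `v` and all `h ≠ 1` in `H`, where `d` is the path metric of the
`1`-skeleton. -/
noncomputable def minDisplacement (H : Subgroup M.Group) : ℕ∞ :=
  ⨅ (v : M.Group) (h : M.Group) (_ : h ∈ H) (_ : h ≠ 1),
    M.davisThickening.oneSkeleton.edist v (h * v)

/-- The vertices of `Y = H \ Σ`: the orbits `Hw` of the left multiplication action of `H` on `W`. -/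
abbrev quotientVertices (H : Subgroup M.Group) : Type u :=
  MulAction.orbitRel.Quotient H M.Group

/-- The cubes of `Y = H \ Σ` (given by their vertex sets): the images of the cubes of `Σ`. -/
def quotientCubes (H : Subgroup M.Group) : Set (Set (M.quotientVertices H)) :=
  (fun c => (Quotient.mk _ : M.Group → M.quotientVertices H) '' c) '' M.davisCubes

theorem exists_mem_quotientCubes (H : Subgroup M.Group) (y : M.quotientVertices H) :
    ∃ c ∈ M.quotientCubes H, y ∈ c := by
  induction y using Quotient.inductionOn with
  | h w =>
    obtain ⟨c, hc, hw⟩ := M.exists_mem_davisCubes w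
    exact ⟨_, ⟨c, hc, rfl⟩, w, hw, rfl⟩

/-- `Th(H \ Σ)`, the thickening of the quotient of the Davis complex. -/
def quotientThickening (H : Subgroup M.Group) : AbstractSimplicialComplex (M.quotientVertices H) :=
  thickening (M.quotientCubes H) (M.exists_mem_quotientCubes H)

end CoxeterMatrix

/-- `BasicConstruction m X₀ X`: the complex `X` is obtained from `X₀` by finitely many (possibly
zero) steps of the basic construction, where all the minimal displacements are at least `m`.
One step takes `X` to `X' = Th(H \ Σ(W, S))`, where `(W, S)` is the right-angled Coxeter system
with nerve `X`, and `H` is a torsion-free subgroup of finite index of `W` whose minimal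
displacement on the `1`-skeleton of `Th(Σ(W, S))` is at least `m`. -/
inductive BasicConstruction (m : ℕ) {V₀ : Type u} (X₀ : AbstractSimplicialComplex V₀) :
    {V : Type u} → AbstractSimplicialComplex V → Prop
  | base : BasicConstruction m X₀ X₀
  | step {V : Type u} {X : AbstractSimplicialComplex V} (hX : BasicConstruction m X₀ X)
      (M : CoxeterMatrix V) (hM : M.IsRightAngled) (hnerve : M.nerve = X)
      (H : Subgroup M.Group) (htorsionFree : ∀ h ∈ H, IsOfFinOrder h → h = 1)
      (hindex : H.FiniteIndex) (hdisp : (m : ℕ∞) ≤ M.minDisplacement H) :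
      BasicConstruction m X₀ (M.quotientThickening H)

/-! Two facts carry the induction over the steps. A right-angled Coxeter system with `k`-large nerve
has a `k`-large thickened Davis complex `Th(Σ)`. A quotient of `Th(Σ)` by a subgroup of displacement
at least `k` is again `k`-large.

The geometry of `Σ` is encoded by inversion sets: `inversions w` is the set of reflections whose
walls separate `1` from `w`. The cocycle rule `mem_inversions_mul` says that the walls separating
`v` from `w` form the symmetric difference of the two inversion sets. Two vertices lie in a common
cube (`Cubical`) iff all walls between them are adjacent to the first one. Such walls commute
pairwise, because distinct left descents commute (`eq_two_of_mem_inversions`). Hence pairwise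
cubical finite sets lie in one cube, which gives flagness.

Holes (induced cycles of length at least 4) are reduced by folding. Among the walls separating `1`
from points of a finite set, one with minimal half-space is adjacent to every point of the set
beyond it (`exists_extremal_wall`). Reflecting such a point in this wall shortens it and keeps its
neighbours in the set (`Cubical.fold`). For a hole, the reflected point either yields a hole that is
no longer and has smaller total word length (`IsHole.shortcut`), or it is adjacent to the whole
hole, which then lies in a vertex link. In the link of `1`, elements are replaced by generators in
the same way, until the hole lies in the nerve.

The same folding collapses each ball of `W` to the point `1`. A path or a homotopy is compact and so
meets only finitely many vertices; hence `Th(Σ)` is simply connected. Links in a `k`-large complex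
are `k`-large, and `W` acts geometrically on `Th(Σ)`, so `W` is `k`-systolic.

For the quotient, a closed path of length less than `k` lifts to a path whose endpoints differ by an
element of `H`. The displacement bound makes this element trivial, so triangles and short holes
lift. -/

namespace CoxeterMatrix

/-! ### Inversion sets and their cocycle rule -/

variable {S : Type u} {M : CoxeterMatrix S}

@[simp] theorem simple_mul_self (s : S) : M.simple s * M.simple s = 1 := by
  simpa using M.toCoxeterSystem.simple_mul_simple_self s

@[simp] theorem inv_simple (s : S) : (M.simple s)⁻¹ = M.simple s :=
  inv_eq_of_mul_eq_one_right (simple_mul_self s)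

@[simp] theorem simple_mul_cancel_left (s : S) (w : M.Group) :
    M.simple s * (M.simple s * w) = w := by
  rw [← mul_assoc, simple_mul_self, one_mul]

theorem conj_simple_eq_iff (s : S) {x y : M.Group} :
    M.simple s * x * M.simple s = y ↔ x = M.simple s * y * M.simple s := by
  constructor <;> rintro rfl <;> simp [mul_assoc]

theorem commute_of_eq_two {s t : S} (h : M s t = 2) : Commute (M.simple s) (M.simple t) := by
  have h1 := M.toCoxeterSystem.simple_mul_simple_pow s t
  rw [h, pow_two] at h1
  have h2 := eq_inv_of_mul_eq_one_left h1
  simpa [Commute, SemiconjBy] using h2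

open Classical in
/-- The action of a simple reflection on pairs of an element `t` and a sign: conjugate `t`, and
change the sign if `t` is the simple reflection itself. -/
noncomputable def signedConj (M : CoxeterMatrix S) (s : S) : Equiv.Perm (M.Group × ZMod 2) :=
  Function.Involutive.toPerm
    (fun p => (M.simple s * p.1 * M.simple s, p.2 + if p.1 = M.simple s then 1 else 0)) (by
      rintro ⟨x, e⟩
      have : (M.simple s * x * M.simple s = M.simple s) ↔ x = M.simple s := by
        rw [conj_simple_eq_iff]; simp
      simp only [this, Prod.mk.injEq]
      constructor
      · simp [mul_assoc]
      · rw [add_assoc, CharTwo.add_self_eq_zero, add_zero])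

open Classical in
theorem signedConj_apply (s : S) (p : M.Group × ZMod 2) :
    M.signedConj s p =
      (M.simple s * p.1 * M.simple s, p.2 + if p.1 = M.simple s then 1 else 0) := rfl

theorem IsRightAngled.isLiftable_signedConj (hM : M.IsRightAngled) :
    M.IsLiftable M.signedConj := by
  classical
  intro s t
  rcases hM s t with h | h | h
  · have : s = t := by_contra fun hne => M.off_diagonal s t hne h
    subst this
    rw [h, pow_one]
    ext1 p
    exact (Function.Involutive.toPerm_involutive (f := _) _) p
  · have hc : M.simple s * M.simple t = M.simple t * M.simple s := commute_of_eq_two h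
    have key : ∀ p, (M.signedConj s * M.signedConj t) p =
        (M.simple s * M.simple t * p.1 * (M.simple s * M.simple t)⁻¹,
          p.2 + ((if p.1 = M.simple t then 1 else 0) + if p.1 = M.simple s then 1 else 0)) := by
      rintro ⟨x, e⟩
      have : M.simple t * x * M.simple t = M.simple s ↔ x = M.simple s := by
        rw [conj_simple_eq_iff, ← hc, mul_assoc, simple_mul_self, mul_one]
      simp only [Equiv.Perm.mul_apply, signedConj_apply, this, mul_inv_rev, inv_simple]
      simp only [mul_assoc, add_assoc]
    rw [h, pow_two]
    ext1 p
    rw [Equiv.Perm.mul_apply, key, key, Equiv.Perm.one_apply]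
    -- Conjugation by `s t` fixes `s` and `t`, so the second application of `s t` repeats the sign
    -- change of the first, and the two cancel modulo 2.
    have hs : ∀ x, M.simple s * M.simple t * x * (M.simple s * M.simple t)⁻¹ = M.simple s ↔
        x = M.simple s := fun x => by
      rw [mul_inv_eq_iff_eq_mul, ← mul_assoc, simple_mul_self, one_mul, hc, mul_assoc]
      constructor
      · intro h
        have := congrArg (fun z => M.simple s * (M.simple t * z)) h
        simpa [← hc] using this
      · rintro rfl; simp
    have ht : ∀ x, M.simple s * M.simple t * x * (M.simple s * M.simple t)⁻¹ = M.simple t ↔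
        x = M.simple t := fun x => by
      rw [mul_inv_eq_iff_eq_mul, hc, ← mul_assoc, simple_mul_self, one_mul, ← hc, mul_assoc]
      constructor
      · intro h
        have := congrArg (fun z => M.simple t * (M.simple s * z)) h
        simpa [hc] using this
      · rintro rfl; simp
    obtain ⟨x, e⟩ := p
    simp only [hs, ht, Prod.mk.injEq]
    constructor
    · have h2 : M.simple t * (M.simple s * (M.simple t * M.simple s)) = 1 := by
        rw [← hc, simple_mul_cancel_left, simple_mul_self]
      have h3 : ∀ z, M.simple s * (M.simple t * (M.simple s * (M.simple t * z))) = z := fun z => by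
        rw [← mul_assoc (M.simple s) (M.simple t) z, hc, mul_assoc, simple_mul_cancel_left,
          simple_mul_cancel_left]
      simp only [mul_assoc, mul_inv_rev, inv_simple, h2, h3, mul_one]
    · rw [add_assoc, CharTwo.add_self_eq_zero, add_zero]
  · rw [h, pow_zero]

/-- The representation on signed elements that computes inversions. -/
noncomputable def signedConjHom (hM : M.IsRightAngled) :
    M.Group →* Equiv.Perm (M.Group × ZMod 2) :=
  M.toCoxeterSystem.lift ⟨M.signedConj, hM.isLiftable_signedConj⟩

@[simp] theorem signedConjHom_simple (hM : M.IsRightAngled) (s : S) :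
    signedConjHom hM (M.simple s) = M.signedConj s := by
  have := M.toCoxeterSystem.lift_apply_simple hM.isLiftable_signedConj s
  exact this

theorem signedConjHom_apply (hM : M.IsRightAngled) (w : M.Group) (t : M.Group) (e : ZMod 2) :
    signedConjHom hM w (t, e) = (w * t * w⁻¹, e + (signedConjHom hM w (t, 0)).2) := by
  induction w using M.toCoxeterSystem.simple_induction_left generalizing e with
  | one => simp
  | mul_simple_left w s ih =>
    rw [M.toCoxeterSystem_simple, map_mul, Equiv.Perm.mul_apply, Equiv.Perm.mul_apply, ih e, ih 0,
      signedConjHom_simple, signedConj_apply, signedConj_apply]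
    simp [mul_assoc, add_assoc]

theorem signedConjHom_mul_snd (hM : M.IsRightAngled) (v w t : M.Group) :
    (signedConjHom hM (v * w) (t, 0)).2 =
      (signedConjHom hM w (t, 0)).2 + (signedConjHom hM v (w * t * w⁻¹, 0)).2 := by
  rw [map_mul, Equiv.Perm.mul_apply, signedConjHom_apply hM w t 0, signedConjHom_apply hM v, zero_add]

open Classical in
theorem signedConjHom_simple_snd (hM : M.IsRightAngled) (s : S) (t : M.Group) :
    (signedConjHom hM (M.simple s) (t, 0)).2 = if t = M.simple s then 1 else 0 := by
  simp [signedConj_apply]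

/-- The sign counts, modulo 2, the occurrences of `t` in the left inversion sequence; an odd count
forces an occurrence. -/
theorem mem_leftInvSeq_of_signedConjHom (hM : M.IsRightAngled) (ω : List S) (t : M.Group)
    (h : (signedConjHom hM (M.toCoxeterSystem.wordProd ω)⁻¹ (t, 0)).2 ≠ 0) :
    t ∈ M.toCoxeterSystem.leftInvSeq ω := by
  classical
  induction ω generalizing t with
  | nil => simp at h
  | cons s ω ih =>
    rw [M.toCoxeterSystem.wordProd_cons, mul_inv_rev, signedConjHom_mul_snd,
      M.toCoxeterSystem_simple, inv_simple, signedConjHom_simple_snd] at h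
    by_cases hts : t = M.simple s
    · simp [CoxeterSystem.leftInvSeq, hts]
    · rw [if_neg hts, zero_add] at h
      have := ih _ h
      simp only [CoxeterSystem.leftInvSeq, List.mem_cons, List.mem_map]
      exact Or.inr ⟨_, this, by simp [mul_assoc]⟩

/-- The word length of an element of a Coxeter group. -/
noncomputable abbrev len (w : M.Group) : ℕ := M.toCoxeterSystem.length w

/-- The inversion set of `w`: the reflections whose walls separate `1` from `w`. -/
def inversions (w : M.Group) : Set M.Group := {t | M.toCoxeterSystem.IsLeftInversion w t}

theorem isReflection_iff {t : M.Group} :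
    M.toCoxeterSystem.IsReflection t ↔ ∃ w s, t = w * M.simple s * w⁻¹ := Iff.rfl

theorem len_mul_lt {w t : M.Group} (h : t ∈ inversions w) : len (t * w) < len w := h.2

theorem isReflection_simple (s : S) : M.toCoxeterSystem.IsReflection (M.simple s) :=
  M.toCoxeterSystem.isReflection_simple s

theorem isLeftInversion_of_signedConjHom (hM : M.IsRightAngled) {w t : M.Group}
    (h : (signedConjHom hM w⁻¹ (t, 0)).2 ≠ 0) : t ∈ inversions w := by
  obtain ⟨ω, hω, rfl⟩ := M.toCoxeterSystem.exists_isReduced w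
  exact M.toCoxeterSystem.isLeftInversion_of_mem_leftInvSeq hω
    (mem_leftInvSeq_of_signedConjHom hM ω t h)

/-- With `t = u s u⁻¹`, the contributions of `u` and `u⁻¹` cancel and only that of `s` remains. -/
theorem signedConjHom_reflection (hM : M.IsRightAngled) {t : M.Group}
    (ht : M.toCoxeterSystem.IsReflection t) : (signedConjHom hM t (t, 0)).2 = 1 := by
  classical
  obtain ⟨u, s, rfl⟩ := isReflection_iff.1 ht
  have h1 := signedConjHom_mul_snd hM u u⁻¹ (u * M.simple s * u⁻¹)
  rw [signedConjHom_mul_snd, signedConjHom_mul_snd, signedConjHom_simple_snd]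
  simp only [mul_inv_cancel, map_one, Equiv.Perm.one_apply, inv_inv, mul_assoc, inv_mul_cancel,
    mul_one, one_mul, inv_mul_cancel_left, inv_simple, simple_mul_self, if_true] at h1 ⊢
  rw [add_left_comm, ← h1, add_zero]

/-- A nonzero sign puts `t` in the inversion sequence of a reduced word. Conversely, passing from
`w` to `t w` flips the sign, so sign 0 at `w` would make `t` an inversion of both `w` and `t w`,
which is impossible for lengths. -/
theorem mem_inversions_iff_signedConjHom (hM : M.IsRightAngled) {w t : M.Group}
    (ht : M.toCoxeterSystem.IsReflection t) :
    t ∈ inversions w ↔ (signedConjHom hM w⁻¹ (t, 0)).2 = 1 := by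
  have h01 : ∀ x : ZMod 2, x ≠ 0 ↔ x = 1 := by decide
  constructor
  · intro h
    by_contra hne
    rw [← h01, not_not] at hne
    have : (signedConjHom hM (t * w)⁻¹ (t, 0)).2 ≠ 0 := by
      rw [mul_inv_rev, signedConjHom_mul_snd, ht.inv, signedConjHom_reflection hM ht]
      have : t * t * t⁻¹ = t := by simp
      rw [this, hne]
      decide
    have h2 := (isLeftInversion_of_signedConjHom hM this).2
    rw [← mul_assoc, ht.mul_self, one_mul] at h2
    exact absurd h.2 (not_lt.2 h2.le)
  · intro h
    exact isLeftInversion_of_signedConjHom hM ((h01 _).2 h)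

/-- The cocycle rule: a wall separates `1` from `v w` iff it separates exactly one of the pairs `1,
v` and `v, v w`. The sign representation turns this into addition in `ZMod 2`. -/
theorem mem_inversions_mul (hM : M.IsRightAngled) {v w t : M.Group} :
    t ∈ inversions (v * w) ↔ Xor (t ∈ inversions v) (v⁻¹ * t * v ∈ inversions w) := by
  have hc : M.toCoxeterSystem.IsReflection (v⁻¹ * t * v) ↔ M.toCoxeterSystem.IsReflection t := by
    simpa using M.toCoxeterSystem.isReflection_conj_iff v⁻¹ t
  by_cases ht : M.toCoxeterSystem.IsReflection t
  · rw [mem_inversions_iff_signedConjHom hM ht, mem_inversions_iff_signedConjHom hM ht,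
      mem_inversions_iff_signedConjHom hM (hc.2 ht), mul_inv_rev, signedConjHom_mul_snd, inv_inv]
    generalize (signedConjHom hM v⁻¹ (t, 0)).2 = a
    generalize (signedConjHom hM w⁻¹ (v⁻¹ * t * v, 0)).2 = b
    revert a b
    unfold Xor
    decide
  · have h1 : t ∉ inversions (v * w) := fun h => ht h.1
    have h2 : t ∉ inversions v := fun h => ht h.1
    have h3 : v⁻¹ * t * v ∉ inversions w := fun h => ht (hc.1 h.1)
    simp [h1, h2, h3, Xor]

@[simp] theorem inversions_one : inversions (1 : M.Group) = ∅ := by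
  ext t
  simp only [Set.mem_empty_iff_false, iff_false]
  intro h
  have := len_mul_lt h
  simp [len] at this

theorem mem_inversions_simple {s : S} {t : M.Group} :
    t ∈ inversions (M.simple s) ↔ t = M.simple s := by
  have hl : len (M.simple s) = 1 := M.toCoxeterSystem.length_simple s
  constructor
  · intro h
    have := len_mul_lt h
    rw [hl, Nat.lt_one_iff, len, M.toCoxeterSystem.length_eq_zero_iff] at this
    rw [eq_inv_of_mul_eq_one_left this, inv_simple]
  · rintro rfl
    refine ⟨isReflection_simple s, ?_⟩
    rw [simple_mul_self]
    exact M.toCoxeterSystem.length_one.trans_lt (lt_of_lt_of_eq one_pos hl.symm)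

theorem eq_one_of_inversions_eq_empty {w : M.Group} (h : inversions w = ∅) : w = 1 := by
  by_contra hne
  obtain ⟨i, hi⟩ := M.toCoxeterSystem.exists_leftDescent_of_ne_one hne
  have : M.simple i ∈ inversions w := ⟨isReflection_simple i, hi⟩
  simp [h] at this

theorem exists_simple_mem_inversions {w : M.Group} (hw : w ≠ 1) :
    ∃ s, M.simple s ∈ inversions w := by
  obtain ⟨i, hi⟩ := M.toCoxeterSystem.exists_leftDescent_of_ne_one hw
  exact ⟨i, isReflection_simple i, hi⟩

theorem mem_leftInvSeq_of_mem_inversions (hM : M.IsRightAngled) {ω : List S} {t : M.Group}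
    (ht : t ∈ inversions (M.toCoxeterSystem.wordProd ω)) : t ∈ M.toCoxeterSystem.leftInvSeq ω := by
  refine mem_leftInvSeq_of_signedConjHom hM ω t ?_
  rw [(mem_inversions_iff_signedConjHom hM ht.1).1 ht]
  decide

theorem inversions_finite (hM : M.IsRightAngled) (w : M.Group) : (inversions w).Finite := by
  obtain ⟨ω, rfl⟩ := M.toCoxeterSystem.wordProd_surjective w
  exact (List.finite_toSet (M.toCoxeterSystem.leftInvSeq ω)).subset fun t ht =>
    mem_leftInvSeq_of_mem_inversions hM ht

/-! ### Commutation of generators and of left descents -/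

/-- Killing all other generators maps `W` to the infinite dihedral group, where the product of the
two reflections is a translation of infinite order. -/
theorem simple_mul_simple_pow_ne_one (hM : M.IsRightAngled) {s t : S} (h : M s t = 0) {n : ℕ}
    (hn : n ≠ 0) : (M.simple s * M.simple t) ^ n ≠ 1 := by
  classical
  have hst : s ≠ t := by
    rintro rfl
    rw [M.diagonal] at h
    exact one_ne_zero h
  have hts : M t s = 0 := by rw [M.symmetric, h]
  let f : S → DihedralGroup 0 := fun i =>
    if i = s then .sr 0 else if i = t then .sr 1 else 1
  have hsq : ∀ i, f i * f i = 1 := by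
    intro i
    simp only [f]
    split_ifs <;> simp
  have hf : M.IsLiftable f := by
    intro i j
    rcases hM i j with h1 | h1 | h1
    · obtain rfl : i = j := by_contra fun hne => M.off_diagonal i j hne h1
      rw [h1, pow_one, hsq]
    · rw [h1, pow_two]
      by_cases hi : f i = 1
      · rw [hi, one_mul, hsq]
      by_cases hj : f j = 1
      · rw [hj, mul_one, hsq]
      have hi' : i = s ∨ i = t := by
        by_contra hc
        push Not at hc
        exact hi (by simp [f, hc])
      have hj' : j = s ∨ j = t := by
        by_contra hc
        push Not at hc
        exact hj (by simp [f, hc])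
      rcases hi' with rfl | rfl <;> rcases hj' with rfl | rfl
      · rw [hsq, one_mul]
      · simp [h] at h1
      · simp [hts] at h1
      · rw [hsq, one_mul]
    · rw [h1, pow_zero]
  let φ := M.toCoxeterSystem.lift ⟨f, hf⟩
  have hφ : ∀ i, φ (M.simple i) = f i := fun i => M.toCoxeterSystem.lift_apply_simple hf i
  intro hc
  have := congrArg φ hc
  rw [map_pow, map_mul, hφ, hφ, map_one] at this
  simp only [f, if_true, if_neg hst.symm, DihedralGroup.sr_mul_sr, DihedralGroup.r_pow,
    DihedralGroup.one_def, DihedralGroup.r.injEq] at this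
  have h2 : ((1 : ℤ) - 0) * n = 0 := this
  simp at h2
  exact hn h2

/-- The alternating word `s t s ⋯` of length `n`. -/
def alternating (s t : S) : ℕ → List S
  | 0 => []
  | n + 1 => s :: alternating t s n

theorem mem_leftInvSeq_alternating (s t : S) (n : ℕ) {x : M.Group}
    (hx : x ∈ M.toCoxeterSystem.leftInvSeq (alternating s t n)) :
    ∃ j : ℕ, x = (M.simple s * M.simple t) ^ j * M.simple s := by
  induction n generalizing s t x with
  | zero => simp [alternating] at hx
  | succ n ih =>
    simp only [alternating, CoxeterSystem.leftInvSeq, List.mem_cons, List.mem_map,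
      toCoxeterSystem_simple] at hx
    rcases hx with rfl | ⟨y, hy, rfl⟩
    · exact ⟨0, by simp⟩
    · obtain ⟨j, rfl⟩ := ih t s hy
      refine ⟨j + 1, ?_⟩
      simp only [MulAut.conj_apply, inv_simple]
      clear hy
      induction j with
      | zero => simp [mul_assoc]
      | succ j ihj =>
        have e1 : M.simple s * ((M.simple t * M.simple s) ^ (j + 1) * M.simple t) * M.simple s =
            M.simple s * M.simple t * (M.simple s * ((M.simple t * M.simple s) ^ j * M.simple t) *
              M.simple s) := by
          rw [pow_succ']; simp only [mul_assoc]
        rw [e1, ihj, pow_succ' _ (j + 1)]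
        simp only [mul_assoc]

theorem exists_alternating_of_mem_closure {s t : S} {q : M.Group}
    (hq : q ∈ Subgroup.closure {M.simple s, M.simple t}) :
    ∃ n, q = M.toCoxeterSystem.wordProd (alternating s t n) ∨
      q = M.toCoxeterSystem.wordProd (alternating t s n) := by
  have key : ∀ (a b : S) (n : ℕ), ∃ m,
      M.simple a * M.toCoxeterSystem.wordProd (alternating a b n) =
        M.toCoxeterSystem.wordProd (alternating b a m) ∨
      M.simple a * M.toCoxeterSystem.wordProd (alternating a b n) =
        M.toCoxeterSystem.wordProd (alternating a b m) := by
    intro a b n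
    cases n with
    | zero => exact ⟨1, Or.inr (by simp [alternating, CoxeterSystem.wordProd])⟩
    | succ n => exact ⟨n, Or.inl (by
        rw [alternating, CoxeterSystem.wordProd_cons, toCoxeterSystem_simple,
          simple_mul_cancel_left])⟩
  have key2 : ∀ (a b : S) (n : ℕ), M.simple a * M.toCoxeterSystem.wordProd (alternating b a n) =
        M.toCoxeterSystem.wordProd (alternating a b (n + 1)) := by
    intro a b n
    rw [alternating, CoxeterSystem.wordProd_cons, toCoxeterSystem_simple]
  have step : ∀ x ∈ ({M.simple s, M.simple t} : Set M.Group), ∀ y,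
      (∃ n, y = M.toCoxeterSystem.wordProd (alternating s t n) ∨
        y = M.toCoxeterSystem.wordProd (alternating t s n)) →
      ∃ n, x * y = M.toCoxeterSystem.wordProd (alternating s t n) ∨
        x * y = M.toCoxeterSystem.wordProd (alternating t s n) := by
    rintro x (rfl | rfl) y ⟨n, rfl | rfl⟩
    · obtain ⟨m, h | h⟩ := key s t n
      exacts [⟨m, Or.inr h⟩, ⟨m, Or.inl h⟩]
    · exact ⟨_, Or.inl (key2 s t n)⟩
    · exact ⟨_, Or.inr (key2 t s n)⟩
    · obtain ⟨m, h | h⟩ := key t s n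
      exacts [⟨m, Or.inl h⟩, ⟨m, Or.inr h⟩]
  induction hq using Subgroup.closure_induction_left with
  | one => exact ⟨0, Or.inl (by simp [alternating])⟩
  | mul_left x hx y _ ih => exact step x hx y ih
  | inv_mul_cancel x hx y _ ih =>
    have : x⁻¹ = x := by rcases hx with rfl | rfl <;> simp
    rw [this]
    exact step x hx y ih

/-- Two distinct left descents of an element of a right-angled Coxeter group commute. -/
theorem eq_two_of_mem_inversions (hM : M.IsRightAngled) {s t : S} (hst : s ≠ t) {y : M.Group}
    (hs : M.simple s ∈ inversions y) (ht : M.simple t ∈ inversions y) : M s t = 2 := by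
  rcases hM s t with h | h | h
  · exact absurd h (M.off_diagonal s t hst)
  · exact h
  exfalso
  let D := Subgroup.closure {M.simple s, M.simple t}
  have hsD : M.simple s ∈ D := Subgroup.subset_closure (by simp)
  have htD : M.simple t ∈ D := Subgroup.subset_closure (by simp)
  -- `z` is a shortest element of the coset `D y`. No reflection in `D` shortens it, so every
  -- inversion of `y = q z` lying in `D` is already an inversion of `q`.
  obtain ⟨z, ⟨q, hq, hqz⟩, hz⟩ : ∃ z, (∃ q ∈ D, y = q * z) ∧
      ∀ z', (∃ q ∈ D, y = q * z') → len z ≤ len z' := by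
    obtain ⟨z, hz, hmin⟩ := WellFounded.has_min (measure (len (M := M))).wf
      {z | ∃ q ∈ D, y = q * z} ⟨y, 1, D.one_mem, by simp⟩
    exact ⟨z, hz, fun z' hz' => not_lt.1 (hmin z' hz')⟩
  have hin : ∀ x ∈ D, x ∈ inversions y → x ∈ inversions q := by
    intro x hx hxy
    rw [hqz, mem_inversions_mul hM] at hxy
    rcases hxy with hxy | hxy
    · exact hxy.1
    · exfalso
      have hc := len_mul_lt hxy.1
      refine absurd (hz (q⁻¹ * x * q * z) ⟨x⁻¹ * q, D.mul_mem (D.inv_mem hx) hq, ?_⟩) (not_le.2 hc)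
      rw [hqz]; group
  have hsq := hin _ hsD hs
  have htq := hin _ htD ht
  -- The inversions of an alternating word starting with `a` have the form `(a b)^j a`; if one of
  -- them were `b`, then `(a b)^(j+1) = 1`.
  have main : ∀ {a b : S} (n : ℕ), M a b = 0 →
      M.simple b ∈ inversions (M.toCoxeterSystem.wordProd (alternating a b n)) → False := by
    intro a b n hab hb
    obtain ⟨j, hj⟩ := mem_leftInvSeq_alternating a b n (mem_leftInvSeq_of_mem_inversions hM hb)
    refine simple_mul_simple_pow_ne_one hM hab (Nat.succ_ne_zero j) ?_
    rw [pow_succ, ← mul_assoc, ← hj, simple_mul_self]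
  obtain ⟨n, rfl | rfl⟩ := exists_alternating_of_mem_closure hq
  · exact main n h htq
  · exact main n (by rw [M.symmetric, h]) hsq

theorem commute_of_mem_inversions (hM : M.IsRightAngled) {s t : S} {y : M.Group}
    (hs : M.simple s ∈ inversions y) (ht : M.simple t ∈ inversions y) :
    Commute (M.simple s) (M.simple t) := by
  by_cases hst : s = t
  · rw [hst]
  · exact commute_of_eq_two (eq_two_of_mem_inversions hM hst hs ht)

theorem commute_iff (hM : M.IsRightAngled) {s t : S} :
    Commute (M.simple s) (M.simple t) ↔ M s t ≠ 0 := by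
  constructor
  · intro h h0
    refine simple_mul_simple_pow_ne_one hM h0 two_ne_zero ?_
    rw [pow_two, mul_assoc, ← mul_assoc (M.simple t), ← h.eq, mul_assoc, simple_mul_self, mul_one,
      simple_mul_self]
  · intro h
    rcases hM s t with h1 | h1 | h1
    · obtain rfl : s = t := by_contra fun hne => M.off_diagonal s t hne h1
      exact Commute.refl _
    · exact commute_of_eq_two h1
    · exact absurd h1 h

/-! ### Vertices in a common cube, and folding along a wall -/

/-- `v` and `w` are vertices of a common cube of the Davis complex: all walls separating them are
adjacent to `v`. -/
def Cubical (v w : M.Group) : Prop := inversions (v⁻¹ * w) ⊆ Set.range M.simple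

theorem cubical_refl (v : M.Group) : Cubical v v := by simp [Cubical]

@[simp] theorem cubical_mul_left (g v w : M.Group) : Cubical (g * v) (g * w) ↔ Cubical v w := by
  unfold Cubical
  rw [mul_inv_rev, mul_assoc, inv_mul_cancel_left]

theorem cubical_one_left {w : M.Group} : Cubical 1 w ↔ inversions w ⊆ Set.range M.simple := by
  simp [Cubical]

theorem mem_inversions_simple_mul (hM : M.IsRightAngled) {s : S} {w t : M.Group} :
    t ∈ inversions (M.simple s * w) ↔
      Xor (t = M.simple s) (M.simple s * t * M.simple s ∈ inversions w) := by
  rw [mem_inversions_mul hM, mem_inversions_simple, inv_simple]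

theorem mem_inversions_inv (hM : M.IsRightAngled) {w t : M.Group} :
    t ∈ inversions w⁻¹ ↔ w * t * w⁻¹ ∈ inversions w := by
  have h : t ∉ inversions (w⁻¹ * w) := by simp
  rw [mem_inversions_mul hM, inv_inv] at h
  unfold Xor at h
  tauto

theorem mem_inversions_inv_mul (hM : M.IsRightAngled) {v w t : M.Group} :
    t ∈ inversions (v⁻¹ * w) ↔ Xor (v * t * v⁻¹ ∈ inversions v) (v * t * v⁻¹ ∈ inversions w) := by
  rw [mem_inversions_mul hM, mem_inversions_inv hM, inv_inv]

theorem mem_inversions_reflection_mul (hM : M.IsRightAngled) {h v : M.Group} {s : S}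
    (hs : v⁻¹ * h * v = M.simple s) {t : M.Group} :
    t ∈ inversions (h * v) ↔ Xor (t ∈ inversions v) (t = h) := by
  have e : h * v = v * M.simple s := by rw [← hs]; group
  rw [e, mem_inversions_mul hM, mem_inversions_simple, ← hs]
  simp

/-- Remove a left descent `s`: since the inversions of `w` are generators commuting with `s`,
conjugation by `s` fixes them, and `s w` has no new inversions. -/
theorem mem_closure_inversions (hM : M.IsRightAngled) {w : M.Group}
    (hw : inversions w ⊆ Set.range M.simple) : w ∈ Subgroup.closure (inversions w) := by
  induction hn : len w using Nat.strong_induction_on generalizing w with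
  | _ n ih =>
  by_cases h1 : w = 1
  · rw [h1]; exact Subgroup.one_mem _
  obtain ⟨s, hs⟩ := exists_simple_mem_inversions h1
  have hsub : inversions (M.simple s * w) ⊆ inversions w := by
    intro t ht
    rw [mem_inversions_simple_mul hM] at ht
    rcases ht with ⟨rfl, _⟩ | ⟨h, _⟩
    · exact hs
    · obtain ⟨r, hr⟩ := hw h
      have hc := commute_of_mem_inversions hM hs (hr ▸ h)
      have : t = M.simple r := by
        have h2 : M.simple s * t * M.simple s = M.simple r := hr.symm
        rw [conj_simple_eq_iff, hc.eq, mul_assoc, simple_mul_self, mul_one] at h2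
        exact h2
      rw [this, hr]; exact h
  have h3 := ih _ (hn ▸ len_mul_lt hs) (hsub.trans hw) rfl
  have h4 := Subgroup.mul_mem _ (Subgroup.subset_closure hs) (Subgroup.closure_mono hsub h3)
  rwa [simple_mul_cancel_left] at h4

theorem commute_of_forall_inversions (hM : M.IsRightAngled) {w x : M.Group}
    (hw : inversions w ⊆ Set.range M.simple) (h : ∀ t ∈ inversions w, Commute x t) :
    Commute x w := by
  have h1 : Subgroup.closure (inversions w) ≤ Subgroup.centralizer {x} := by
    rw [Subgroup.closure_le]
    intro t ht
    rw [SetLike.mem_coe, Subgroup.mem_centralizer_singleton_iff]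
    exact (h t ht).symm.eq
  exact (Subgroup.mem_centralizer_singleton_iff.1 (h1 (mem_closure_inversions hM hw))).symm

theorem commute_of_mem_of_cubical (hM : M.IsRightAngled) {w x y : M.Group}
    (hw : inversions w ⊆ Set.range M.simple) (hx : x ∈ inversions w) (hy : y ∈ inversions w) :
    Commute x y := by
  obtain ⟨s, rfl⟩ := hw hx
  obtain ⟨t, rfl⟩ := hw hy
  exact commute_of_mem_inversions hM hx hy

theorem eq_conj_of_commute {G : Type*} [Group G] {y t : G} (h : Commute (y * t * y⁻¹) y) :
    t = y * t * y⁻¹ := by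
  refine mul_left_cancel (a := y) ?_
  rw [← h.eq]
  group

/-- The difference `y = v⁻¹ w` is a product of its own pairwise commuting inversions, so conjugation
by `y`, which relates the inversions of `y` and `y⁻¹`, is trivial on them. -/
theorem Cubical.symm (hM : M.IsRightAngled) {v w : M.Group} (h : Cubical v w) : Cubical w v := by
  have e : w⁻¹ * v = (v⁻¹ * w)⁻¹ := by group
  unfold Cubical at h ⊢
  rw [e]
  generalize v⁻¹ * w = y at h
  intro t ht
  rw [mem_inversions_inv hM] at ht
  have hc := commute_of_forall_inversions hM h fun x hx => commute_of_mem_of_cubical hM h ht hx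
  rw [eq_conj_of_commute hc]
  exact h ht

/-- Two elements of spherical special subgroups lie in a common cube through `1` iff their
inversions commute. -/
theorem cubical_iff_commute (hM : M.IsRightAngled) {x y : M.Group}
    (hx : Cubical 1 x) (hy : Cubical 1 y) :
    Cubical x y ↔ ∀ a ∈ inversions x, ∀ b ∈ inversions y, Commute a b := by
  rw [cubical_one_left] at hx hy
  constructor
  · intro h a ha b hb
    by_cases ha' : a ∈ inversions y
    · exact commute_of_mem_of_cubical hM hy ha' hb
    by_cases hb' : b ∈ inversions x
    · exact commute_of_mem_of_cubical hM hx ha hb'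
    have h1 : x⁻¹ * a * x ∈ inversions (x⁻¹ * y) := by
      rw [mem_inversions_inv_mul hM]
      have : x * (x⁻¹ * a * x) * x⁻¹ = a := by group
      rw [this]
      exact Or.inl ⟨ha, ha'⟩
    have h2 : x⁻¹ * b * x ∈ inversions (x⁻¹ * y) := by
      rw [mem_inversions_inv_mul hM]
      have : x * (x⁻¹ * b * x) * x⁻¹ = b := by group
      rw [this]
      exact Or.inr ⟨hb, hb'⟩
    have h3 := (commute_of_mem_of_cubical hM h h1 h2).eq
    have h4 := congrArg (fun z => x * z * x⁻¹) h3
    have e : ∀ p q : M.Group, x * (x⁻¹ * p * x * (x⁻¹ * q * x)) * x⁻¹ = p * q := by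
      intro p q; group
    simp only [e] at h4
    exact h4
  · intro h t ht
    rw [mem_inversions_inv_mul hM] at ht
    have hcx : ∀ z, (z ∈ inversions x ∨ z ∈ inversions y) → Commute z x := by
      rintro z (hz | hz)
      · exact commute_of_forall_inversions hM hx fun t ht => commute_of_mem_of_cubical hM hx hz ht
      · exact commute_of_forall_inversions hM hx fun t ht => (h t ht z hz).symm
    have hor : x * t * x⁻¹ ∈ inversions x ∨ x * t * x⁻¹ ∈ inversions y := by
      rcases ht with h | h
      exacts [Or.inl h.1, Or.inr h.1]
    have h5 := hcx _ hor
    rw [eq_conj_of_commute h5]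
    exact hor.elim (fun h => hx h) fun h => hy h

/-- Folding along a wall `h` does not destroy cubical adjacency with vertices that are on the other
side of the wall or adjacent to it. -/
theorem Cubical.fold (hM : M.IsRightAngled) {h v u : M.Group} {s : S}
    (hs : v⁻¹ * h * v = M.simple s) (hv : h ∈ inversions v)
    (hu : h ∈ inversions u → u⁻¹ * h * u ∈ Set.range M.simple) (hvu : Cubical v u) :
    Cubical (h * v) u := by
  have e : (h * v)⁻¹ * u = M.simple s * (v⁻¹ * u) := by
    have : h * v = v * M.simple s := by rw [← hs]; group
    rw [this]; simp [mul_assoc]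
  have hh : h = v * M.simple s * v⁻¹ := by rw [← hs]; group
  unfold Cubical at hvu ⊢
  rw [e]
  have hmem : M.simple s ∈ inversions (v⁻¹ * u) ↔ h ∉ inversions u := by
    rw [mem_inversions_inv_mul hM, ← hh]
    simp [hv, Xor]
  -- If `u` is also beyond `h`, the fold adds `h` to the walls between the two points, and it is
  -- still adjacent; otherwise the fold removes `h` from these walls.
  by_cases hu' : h ∈ inversions u
  · obtain ⟨r, hr⟩ := hu hu'
    have e2 : M.simple s * (v⁻¹ * u) = (v⁻¹ * u) * M.simple r := by
      rw [hr, hh]; simp [mul_assoc]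
    rw [e2]
    intro t ht
    rw [mem_inversions_mul hM, mem_inversions_simple] at ht
    rcases ht with ht | ht
    · exact hvu ht.1
    · refine ⟨s, ?_⟩
      have := ht.1
      rw [hr, hh] at this
      refine mul_right_cancel (b := v⁻¹ * u) (mul_left_cancel (a := (v⁻¹ * u)⁻¹) ?_)
      rw [← mul_assoc (v⁻¹ * u)⁻¹ t, this]
      group
  · rw [← hmem] at hu'
    intro t ht
    rw [mem_inversions_simple_mul hM] at ht
    rcases ht with ht | ht
    · exact ⟨s, ht.1.symm⟩
    · have hc := (commute_of_mem_of_cubical hM hvu hu' ht.1).eq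
      have : M.simple s * t * M.simple s = t := by
        have h2 : t * M.simple s = M.simple s * t := by simpa [mul_assoc] using hc
        rw [mul_assoc, h2, simple_mul_cancel_left]
      exact this ▸ hvu ht.1

/-! ### Half-spaces and extremal walls -/

/-- The half-space of the wall of `h` not containing `1`. -/
def halfSpace (h : M.Group) : Set M.Group := {w | h ∈ inversions w}

/-- Take a left descent `t` of `s y`. If it does not commute with `s`, the wall of `s t s` lies
behind that of `s`. If it does, left translation by `t` preserves the wall of `s` and its half-space
and shortens `y`, so induction applies. -/
theorem exists_halfSpace_ssubset_of_simple (hM : M.IsRightAngled) {y : M.Group} {s : S}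
    (hs : M.simple s ∈ inversions y) (hy : y⁻¹ * M.simple s * y ∉ Set.range M.simple) :
    ∃ g ∈ inversions y, halfSpace g ⊆ halfSpace (M.simple s) ∧ g ≠ M.simple s := by
  induction hn : len y using Nat.strong_induction_on generalizing y with
  | _ n ih =>
  have hsq : M.simple s * y ≠ 1 := by
    intro h1
    have : y = M.simple s := by rw [eq_inv_of_mul_eq_one_right h1, inv_simple]
    exact hy ⟨s, by simp [this]⟩
  obtain ⟨t, ht⟩ := exists_simple_mem_inversions hsq
  have hts : M.simple t ≠ M.simple s := by
    intro he
    rw [he, mem_inversions_simple_mul hM] at ht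
    simp [hs, Xor] at ht
  have hty : M.simple s * M.simple t * M.simple s ∈ inversions y := by
    rw [mem_inversions_simple_mul hM] at ht
    rcases ht with ht | ht
    exacts [absurd ht.1 hts, ht.1]
  by_cases hc : Commute (M.simple s) (M.simple t)
  · have hty' : M.simple t ∈ inversions y := by
      rw [hc.eq, mul_assoc, simple_mul_self, mul_one] at hty
      exact hty
    have htst : M.simple t * M.simple s * M.simple t = M.simple s := by
      rw [← hc.eq, mul_assoc, simple_mul_self, mul_one]
    have h1 : M.simple s ∈ inversions (M.simple t * y) := by
      rw [mem_inversions_simple_mul hM, htst]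
      exact Or.inr ⟨hs, fun h => hts h.symm⟩
    obtain ⟨g, hg, hsub, hne⟩ := ih _ (hn ▸ len_mul_lt hty') h1 (by
      have : (M.simple t * y)⁻¹ * M.simple s * (M.simple t * y) = y⁻¹ * M.simple s * y := by
        calc _ = y⁻¹ * (M.simple t * M.simple s * M.simple t) * y := by simp [mul_assoc]
          _ = _ := by rw [htst]
      rwa [this]) rfl
    have hgt : g ≠ M.simple t := by
      rintro rfl
      have : M.simple t ∈ halfSpace (M.simple s) := hsub (mem_inversions_simple.2 rfl)
      exact hts (mem_inversions_simple.1 this).symm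
    have hmem : ∀ w, M.simple t * g * M.simple t ∈ inversions w ↔
        g ∈ inversions (M.simple t * w) := by
      intro w
      rw [mem_inversions_simple_mul hM]
      simp [hgt, Xor]
    refine ⟨M.simple t * g * M.simple t, (hmem y).2 hg, fun w hw => ?_, fun h => hne ?_⟩
    · have h2 : M.simple s ∈ inversions (M.simple t * w) := hsub ((hmem w).1 hw)
      rw [mem_inversions_simple_mul hM, htst] at h2
      rcases h2 with h2 | h2
      exacts [absurd h2.1.symm hts, h2.1]
    · rwa [conj_simple_eq_iff, htst] at h
  · refine ⟨_, hty, fun w hw => ?_, fun h => hts ?_⟩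
    · by_contra hsw
      refine hc (commute_of_mem_inversions hM (y := M.simple s * w) ?_ ?_)
      · rw [mem_inversions_simple_mul hM]
        refine Or.inl ⟨rfl, ?_⟩
        simpa using (show M.simple s ∉ inversions w from hsw)
      · rw [mem_inversions_simple_mul hM]
        exact Or.inr ⟨hw, hts⟩
    · rw [conj_simple_eq_iff] at h
      simpa using h

/-- Here `p` is the endpoint, on the side of `1`, of an edge crossing the wall. Translation by `p⁻¹`
then carries the half-space of `h` to that of a generator. -/
theorem exists_conj_eq_of_isReflection (hM : M.IsRightAngled) {h : M.Group}
    (hh : M.toCoxeterSystem.IsReflection h) :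
    ∃ (p : M.Group) (s : S), h = p * M.simple s * p⁻¹ ∧ h ∉ inversions p := by
  obtain ⟨u, s, rfl⟩ := isReflection_iff.1 hh
  by_cases hu : u * M.simple s * u⁻¹ ∈ inversions u
  · refine ⟨u * M.simple s, s, by simp [mul_assoc], ?_⟩
    rw [mem_inversions_mul hM, mem_inversions_simple]
    have : u⁻¹ * (u * M.simple s * u⁻¹) * u = M.simple s := by group
    simp [this, hu, Xor]
  · exact ⟨u, s, rfl, hu⟩

/-- If a wall separates `1` from `a` and is not adjacent to `a`, then a wall with a strictly smaller
half-space separates `1` from `a`. -/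
theorem exists_halfSpace_ssubset (hM : M.IsRightAngled) {a h : M.Group} (ha : h ∈ inversions a)
    (hs : a⁻¹ * h * a ∉ Set.range M.simple) : ∃ g ∈ inversions a, halfSpace g ⊂ halfSpace h := by
  obtain ⟨p, s, rfl, hp⟩ := exists_conj_eq_of_isReflection hM ha.1
  have htr : ∀ g w, p * g * p⁻¹ ∈ inversions w ↔
      Xor (p * g * p⁻¹ ∈ inversions p) (g ∈ inversions (p⁻¹ * w)) := by
    intro g w
    have h2 : p * g * p⁻¹ ∈ inversions (p * (p⁻¹ * w)) ↔ _ := mem_inversions_mul hM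
    have e : p⁻¹ * (p * g * p⁻¹) * p = g := by group
    rwa [mul_inv_cancel_left, e] at h2
  have hs1 : ∀ w, p * M.simple s * p⁻¹ ∈ inversions w ↔ M.simple s ∈ inversions (p⁻¹ * w) := by
    intro w
    rw [htr]; simp [hp, Xor]
  obtain ⟨g, hg, hsub, hne⟩ := exists_halfSpace_ssubset_of_simple hM ((hs1 a).1 ha) (by
    simpa [mul_assoc] using hs)
  -- Otherwise `p⁻¹` would lie beyond `g`, hence beyond `s`, which translates to `1` lying beyond
  -- `h`.
  have hgp : p * g * p⁻¹ ∉ inversions p := by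
    intro hgp
    have h3 := (htr g 1).not.1 (by simp)
    have : g ∈ inversions (p⁻¹ * 1) := by
      unfold Xor at h3
      tauto
    have h4 := (hs1 1).2 (hsub this)
    simp at h4
  have hg1 : ∀ w, p * g * p⁻¹ ∈ inversions w ↔ g ∈ inversions (p⁻¹ * w) := by
    intro w
    rw [htr]; simp [hgp, Xor]
  refine ⟨p * g * p⁻¹, (hg1 a).2 hg, fun w hw => (hs1 w).2 (hsub ((hg1 w).1 hw)), fun hle => ?_⟩
  -- Strictness is witnessed by `p s`: the only wall separating it from `p` is `h` itself.
  have h5 : p * M.simple s ∈ halfSpace (p * M.simple s * p⁻¹) :=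
    (hs1 _).2 (by simp [mem_inversions_simple])
  have h6 := (hg1 _).1 (hle h5)
  rw [inv_mul_cancel_left, mem_inversions_simple] at h6
  exact hne h6

/-- A wall with minimal half-space among those separating `1` from points of `A` is adjacent to
all the points of `A` beyond it. -/
theorem exists_extremal_wall (hM : M.IsRightAngled) {A : Set M.Group} (hA : A.Finite)
    (hne : ∃ a ∈ A, a ≠ 1) :
    ∃ h, (∃ a ∈ A, h ∈ inversions a) ∧
      ∀ a ∈ A, h ∈ inversions a → a⁻¹ * h * a ∈ Set.range M.simple := by
  have hfin : (⋃ a ∈ A, inversions a).Finite := hA.biUnion fun a _ => inversions_finite hM a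
  obtain ⟨a, ha, ha1⟩ := hne
  obtain ⟨s, hs⟩ := exists_simple_mem_inversions ha1
  obtain ⟨h, hh⟩ := hfin.exists_minimalFor halfSpace _ ⟨M.simple s, Set.mem_biUnion ha hs⟩
  refine ⟨h, by simpa using hh.1, fun b hb hhb => ?_⟩
  by_contra hc
  obtain ⟨g, hg, hlt⟩ := exists_halfSpace_ssubset hM hhb hc
  exact hlt.not_subset (hh.2 (Set.mem_biUnion hb hg) hlt.subset)

/-! ### Spherical subsets and cubes -/

theorem inversions_injective (hM : M.IsRightAngled) :
    Function.Injective (inversions : M.Group → Set M.Group) := by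
  intro v w h
  have : v⁻¹ * w = 1 := by
    refine eq_one_of_inversions_eq_empty (Set.eq_empty_iff_forall_notMem.2 fun t ht => ?_)
    rw [mem_inversions_inv_mul hM, h] at ht
    simp [Xor] at ht
  exact inv_mul_eq_one.1 this

theorem inversions_subset_of_mem_specialSubgroup (hM : M.IsRightAngled) {T : Finset S}
    (hT : ∀ s ∈ T, ∀ t ∈ T, M s t ≠ 0) {w : M.Group} (hw : w ∈ M.specialSubgroup T) :
    inversions w ⊆ M.simple '' T := by
  have step : ∀ x ∈ M.simple '' (T : Set S), ∀ y, inversions y ⊆ M.simple '' T →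
      inversions (x * y) ⊆ M.simple '' T := by
    rintro _ ⟨s, hs, rfl⟩ y hy t ht
    rw [mem_inversions_simple_mul hM] at ht
    rcases ht with ht | ht
    · exact ⟨s, hs, ht.1.symm⟩
    · obtain ⟨r, hr, hrt⟩ := hy ht.1
      have hc := (commute_iff hM).2 (hT s hs r hr)
      refine ⟨r, hr, ?_⟩
      rw [eq_comm, conj_simple_eq_iff, hc.eq, mul_assoc, simple_mul_self, mul_one] at hrt
      exact hrt.symm
  unfold specialSubgroup at hw
  induction hw using Subgroup.closure_induction_left with
  | one => simp
  | mul_left x hx y _ ih => exact step x hx y ih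
  | inv_mul_cancel x hx y _ ih =>
    have : x⁻¹ = x := by obtain ⟨s, -, rfl⟩ := hx; simp
    rw [this]
    exact step x hx y ih

/-- A pair with `m = ∞` gives an element of infinite order. If there is none, inversion sets embed
`W_T` into the subsets of a finite set of generators. -/
theorem isSpherical_iff (hM : M.IsRightAngled) {T : Finset S} :
    M.IsSpherical T ↔ ∀ s ∈ T, ∀ t ∈ T, M s t ≠ 0 := by
  constructor
  · intro h s hs t ht h0
    have hfin : Finite (M.specialSubgroup T) := h
    have hs' : M.simple s ∈ M.specialSubgroup T := Subgroup.subset_closure ⟨s, hs, rfl⟩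
    have ht' : M.simple t ∈ M.specialSubgroup T := Subgroup.subset_closure ⟨t, ht, rfl⟩
    obtain ⟨n, hn, h1⟩ := isOfFinOrder_iff_pow_eq_one.1
      (isOfFinOrder_of_finite (⟨_, mul_mem hs' ht'⟩ : M.specialSubgroup T))
    exact simple_mul_simple_pow_ne_one hM h0 hn.ne' (congrArg Subtype.val h1)
  · intro h
    have hfin : (𝒫 (M.simple '' (T : Set S))).Finite := (T.finite_toSet.image _).finite_subsets
    exact Set.Finite.of_injOn (f := inversions)
      (fun w hw => inversions_subset_of_mem_specialSubgroup hM h hw)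
      (inversions_injective hM).injOn hfin

theorem cubical_one_of_mem_specialSubgroup (hM : M.IsRightAngled) {T : Finset S}
    (hT : M.IsSpherical T) {w : M.Group} (hw : w ∈ M.specialSubgroup T) : Cubical 1 w :=
  cubical_one_left.2 ((inversions_subset_of_mem_specialSubgroup hM
    ((isSpherical_iff hM).1 hT) hw).trans (Set.image_subset_range _ _))

theorem cubical_of_mem_davisCubes (hM : M.IsRightAngled) {c : Set M.Group}
    (hc : c ∈ M.davisCubes) {v w : M.Group} (hv : v ∈ c) (hw : w ∈ c) : Cubical v w := by
  obtain ⟨g, T, hT, rfl⟩ := hc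
  obtain ⟨x, hx, rfl⟩ := hv
  obtain ⟨y, hy, rfl⟩ := hw
  have h := cubical_one_of_mem_specialSubgroup hM hT
    ((M.specialSubgroup T).mul_mem ((M.specialSubgroup T).inv_mem hx) hy)
  rw [← cubical_mul_left (g * x)] at h
  simpa [mul_assoc] using h

/-- Finite sets of vertices of the Davis complex that pairwise lie in common cubes lie in a common
cube. -/
theorem exists_mem_davisCubes_of_cubical (hM : M.IsRightAngled) {P : Finset M.Group}
    (hne : P.Nonempty) (hP : ∀ v ∈ P, ∀ w ∈ P, Cubical v w) :
    ∃ c ∈ M.davisCubes, (P : Set M.Group) ⊆ c := by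
  obtain ⟨g, hg⟩ := hne
  have h1 : ∀ v ∈ P, Cubical 1 (g⁻¹ * v) := fun v hv => by
    rw [← cubical_mul_left g, mul_one, mul_inv_cancel_left]
    exact hP g hg v hv
  have h2 : ∀ v ∈ P, ∀ w ∈ P, ∀ a ∈ inversions (g⁻¹ * v), ∀ b ∈ inversions (g⁻¹ * w),
      Commute a b := fun v hv w hw =>
    (cubical_iff_commute hM (h1 v hv) (h1 w hw)).1 ((cubical_mul_left _ _ _).2 (hP v hv w hw))
  have hfin : (⋃ v ∈ P, inversions (g⁻¹ * v)).Finite :=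
    P.finite_toSet.biUnion fun v _ => inversions_finite hM _
  have hsub : (⋃ v ∈ P, inversions (g⁻¹ * v)) ⊆ M.simple '' Set.univ := by
    rw [Set.image_univ]
    exact Set.iUnion₂_subset fun v hv => cubical_one_left.1 (h1 v hv)
  -- After translating `g` to `1`, the required `T` consists of generators representing all
  -- inversions that occur; these commute pairwise by `h2`.
  obtain ⟨T, -, hTfin, hT⟩ := (Set.exists_subset_image_finite_and
    (p := fun U => U = ⋃ v ∈ P, inversions (g⁻¹ * v))).1 ⟨_, hsub, hfin, rfl⟩
  have hTsph : M.IsSpherical hTfin.toFinset := by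
    rw [isSpherical_iff hM]
    intro s hs t ht
    rw [Set.Finite.mem_toFinset] at hs ht
    have hs1 := hT.subset (Set.mem_image_of_mem _ hs)
    have ht1 := hT.subset (Set.mem_image_of_mem _ ht)
    simp only [Set.mem_iUnion] at hs1 ht1
    obtain ⟨v, hv, hsv⟩ := hs1
    obtain ⟨w, hw, htw⟩ := ht1
    exact (commute_iff hM).1 (h2 v hv w hw _ hsv _ htw)
  refine ⟨_, ⟨g, _, hTsph, rfl⟩, fun v hv => ⟨g⁻¹ * v, ?_, mul_inv_cancel_left g v⟩⟩
  refine Subgroup.closure_mono ?_ (mem_closure_inversions hM (cubical_one_left.1 (h1 v hv)))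
  rw [Set.Finite.coe_toFinset, hT]
  exact Set.subset_biUnion_of_mem (u := fun v => inversions (g⁻¹ * v)) hv

theorem mem_davisThickening_iff (hM : M.IsRightAngled) {P : Finset M.Group} :
    P ∈ M.davisThickening ↔ P.Nonempty ∧ ∀ v ∈ P, ∀ w ∈ P, Cubical v w := by
  constructor
  · rintro ⟨hne, c, hc, hPc⟩
    exact ⟨hne, fun v hv w hw => cubical_of_mem_davisCubes hM hc (hPc hv) (hPc hw)⟩
  · rintro ⟨hne, hP⟩
    exact ⟨hne, exists_mem_davisCubes_of_cubical hM hne hP⟩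

end CoxeterMatrix

/-! ### Holes of a reflexive symmetric relation -/

/-- The vertices `c 0, …, c (n-1)` form an induced cycle of length `n ≥ 4` of the reflexive relation
`E`. -/
def IsHole {V : Type*} (E : V → V → Prop) (n : ℕ) (c : ℕ → V) : Prop :=
  4 ≤ n ∧ ∀ i j, i < j → j < n → (E (c i) (c j) ↔ j = i + 1 ∨ (i = 0 ∧ j = n - 1))

namespace IsHole

variable {V : Type*} {E : V → V → Prop} {n : ℕ} {c : ℕ → V}

/-- Equal vertices are related by reflexivity, hence consecutive on the cycle, and would share all
neighbours; consecutive vertices of a cycle of length at least 4 do not. -/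
theorem ne (hrefl : ∀ v, E v v) (hsymm : ∀ v w, E v w → E w v) (h : IsHole E n c) {i j : ℕ}
    (hij : i < j) (hj : j < n) : c i ≠ c j := by
  intro he
  have h4 := h.1
  have h1 := (h.2 i j hij hj).1 (he ▸ hrefl _)
  rcases h1 with rfl | ⟨rfl, rfl⟩
  · by_cases hi : i = 0
    · subst hi
      have h2 := (h.2 1 2 (by omega) (by omega)).2 (by omega)
      have h3 := (h.2 0 2 (by omega) (by omega)).1 (by rw [he]; exact h2)
      omega
    · have h2 := (h.2 (i - 1) i (by omega) (by omega)).2 (by omega)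
      have h3 := (h.2 (i - 1) (i + 1) (by omega) (by omega)).1 (he ▸ h2)
      omega
  · have h2 := (h.2 0 1 (by omega) (by omega)).2 (by omega)
    have h3 := (h.2 1 (n - 1) (by omega) (by omega)).1 (hsymm _ _ (he ▸ h2))
    omega

theorem rotate_one (hsymm : ∀ v w, E v w → E w v) (h : IsHole E n c) (μ : V → ℕ) :
    ∃ d, IsHole E n d ∧ (∀ i, i + 1 < n → d i = c (i + 1)) ∧ d (n - 1) = c 0 ∧
      ∑ i ∈ Finset.range n, μ (d i) = ∑ i ∈ Finset.range n, μ (c i) := by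
  have h4 := h.1
  refine ⟨fun i => if i + 1 < n then c (i + 1) else c 0, ⟨h4, fun i j hij hj => ?_⟩, ?_, ?_, ?_⟩
  · have hi : i + 1 < n := by omega
    simp only [hi, if_true]
    split_ifs with hj1
    · rw [h.2 _ _ (by omega) hj1]
      omega
    · have : E (c (i + 1)) (c 0) ↔ E (c 0) (c (i + 1)) := ⟨hsymm _ _, hsymm _ _⟩
      rw [this, h.2 _ _ (by omega) hi]
      omega
  · intro i hi
    simp [hi]
  · simp [show ¬ (n - 1 + 1 < n) by omega]
  · obtain ⟨m, rfl⟩ : ∃ m, n = m + 1 := ⟨n - 1, by omega⟩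
    rw [Finset.sum_range_succ, Finset.sum_range_succ']
    simp only [lt_self_iff_false, if_false]
    congr 1
    refine Finset.sum_congr rfl fun i hi => ?_
    rw [if_pos (by simpa using hi)]

/-- Moves a chosen vertex to index `0`, where `shortcut` acts, without introducing new vertices or
changing the total weight. -/
theorem rotate (hsymm : ∀ v w, E v w → E w v) (h : IsHole E n c) (μ : V → ℕ) {r : ℕ}
    (hr : r < n) : ∃ d, IsHole E n d ∧ d 0 = c r ∧ (∀ i < n, ∃ j < n, d i = c j) ∧
      ∑ i ∈ Finset.range n, μ (d i) = ∑ i ∈ Finset.range n, μ (c i) := by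
  induction r generalizing c with
  | zero => exact ⟨c, h, rfl, fun i hi => ⟨i, hi, rfl⟩, rfl⟩
  | succ r ih =>
    obtain ⟨d, hd, h1, h2, h3⟩ := h.rotate_one hsymm μ
    obtain ⟨e, he, he0, he1, he2⟩ := ih hd (by omega)
    refine ⟨e, he, he0.trans (h1 r hr), fun i hi => ?_, he2.trans h3⟩
    obtain ⟨j, hj, hij⟩ := he1 i hi
    by_cases hj1 : j + 1 < n
    · exact ⟨j + 1, hj1, hij.trans (h1 j hj1)⟩
    · obtain rfl : j = n - 1 := by omega
      exact ⟨0, by omega, hij.trans h2⟩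

/-- If `x` is related to the two neighbours of `c 0`, but not to all the vertices of the hole, then
`x` closes up an arc of the hole to a hole. -/
theorem shortcut (h : IsHole E n c) (μ : V → ℕ) {x : V} (hx : μ x < μ (c 0))
    (h1 : E x (c 1)) (h2 : E x (c (n - 1))) {j : ℕ} (hj : 0 < j) (hjn : j < n)
    (hxj : ¬ E x (c j)) :
    ∃ m d, m ≤ n ∧ IsHole E m d ∧ (∀ i < m, d i = x ∨ ∃ l < n, d i = c l) ∧
      ∑ i ∈ Finset.range m, μ (d i) < ∑ i ∈ Finset.range n, μ (c i) := by
  classical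
  have h4 := h.1
  obtain ⟨a, ha1, haj, hxa, hamax⟩ : ∃ a, 1 ≤ a ∧ a < j ∧ E x (c a) ∧
      ∀ i, a < i → i ≤ j → ¬ E x (c i) := by
    have hj1 : 1 < j := by
      rcases Nat.lt_or_ge 1 j with h | h
      · exact h
      · obtain rfl : j = 1 := by omega
        exact absurd h1 hxj
    let P : ℕ → Prop := fun i => 1 ≤ i ∧ E x (c i)
    have hP1 : P 1 := ⟨le_rfl, h1⟩
    have hspec : P (Nat.findGreatest P j) := Nat.findGreatest_spec (m := 1) hj1.le hP1
    refine ⟨Nat.findGreatest P j, hspec.1, ?_, hspec.2, fun i hi hij he => ?_⟩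
    · refine lt_of_le_of_ne (Nat.findGreatest_le j) fun he => hxj ?_
      have := hspec.2
      rwa [he] at this
    · exact Nat.findGreatest_is_greatest hi hij ⟨by omega, he⟩
  obtain ⟨b, hjb, hbn, hxb, hbmin⟩ : ∃ b, j < b ∧ b < n ∧ E x (c b) ∧
      ∀ i, j ≤ i → i < b → ¬ E x (c i) := by
    have hjn1 : j < n - 1 := by
      rcases Nat.lt_or_ge j (n - 1) with h | h
      · exact h
      · obtain rfl : j = n - 1 := by omega
        exact absurd h2 hxj
    have hex : ∃ b, j ≤ b ∧ E x (c b) := ⟨n - 1, hjn1.le, h2⟩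
    have hspec := Nat.find_spec hex
    refine ⟨Nat.find hex, ?_, ?_, hspec.2, fun i hi hib he => Nat.find_min hex hib ⟨hi, he⟩⟩
    · refine lt_of_le_of_ne hspec.1 fun he => hxj ?_
      have := hspec.2
      rwa [← he] at this
    · exact (Nat.find_min' hex ⟨hjn1.le, h2⟩).trans_lt (by omega)
  -- The new hole is `x, c a, …, c b`, with `a` and `b` the neighbours of `x` nearest to `j` on
  -- either side. Since `a < j < b`, its length is at least 4.
  refine ⟨b - a + 2, fun i => if i = 0 then x else c (a + i - 1), by omega,
    ⟨by omega, fun p q hpq hq => ?_⟩, fun i hi => ?_, ?_⟩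
  · have hq0 : q ≠ 0 := by omega
    simp only [hq0, if_false]
    split_ifs with hp
    · constructor
      · intro he
        by_contra hc
        rcases Nat.lt_or_ge j (a + q - 1) with hlt | hge
        · exact hbmin _ hlt.le (by omega) he
        · exact hamax _ (by omega) hge he
      · rintro (hq1 | hq1)
        · have : a + q - 1 = a := by omega
          rwa [this]
        · have : a + q - 1 = b := by omega
          rwa [this]
    · rw [h.2 _ _ (by omega) (by omega)]
      omega
  · by_cases hi0 : i = 0
    · exact Or.inl (by simp [hi0])
    · exact Or.inr ⟨a + i - 1, by omega, by simp [hi0]⟩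
  · rw [Finset.sum_range_succ' _ (b - a + 1)]
    simp only [Nat.add_eq_zero_iff, one_ne_zero, and_false, if_false, if_true]
    have e1 : ∑ i ∈ Finset.range (b - a + 1), μ (c (a + (i + 1) - 1)) =
        ∑ i ∈ Finset.Ico a (b + 1), μ (c i) := by
      rw [Finset.sum_Ico_eq_sum_range, show b + 1 - a = b - a + 1 by omega]
      exact Finset.sum_congr rfl fun i _ => by rw [show a + (i + 1) - 1 = a + i by omega]
    have e2 : ∑ i ∈ Finset.range n, μ (c i) = ∑ i ∈ Finset.Ico 1 n, μ (c i) + μ (c 0) := by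
      rw [Finset.range_eq_Ico, Finset.sum_eq_sum_Ico_succ_bot (by omega), add_comm]
    have e3 : ∑ i ∈ Finset.Ico a (b + 1), μ (c i) ≤ ∑ i ∈ Finset.Ico 1 n, μ (c i) :=
      Finset.sum_le_sum_of_subset (Finset.Ico_subset_Ico ha1 (by omega))
    rw [e1, e2]
    omega

end IsHole

/-! ### From holes of the thickened Davis complex to holes of the nerve -/

namespace CoxeterMatrix

variable {S : Type u} {M : CoxeterMatrix S}

/-- Two generators span a simplex of the nerve, or are equal. -/
def Joined (M : CoxeterMatrix S) (s t : S) : Prop := M s t ≠ 0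

theorem Cubical.simple_left (hM : M.IsRightAngled) {t : S} {x y : M.Group} (hx : Cubical 1 x)
    (hy : Cubical 1 y) (ht : M.simple t ∈ inversions x) (hxy : Cubical x y) :
    Cubical (M.simple t) y := by
  have h1 : Cubical 1 (M.simple t) := by
    rw [cubical_one_left]
    intro z hz
    rw [mem_inversions_simple.1 hz]
    exact ⟨t, rfl⟩
  rw [cubical_iff_commute hM h1 hy]
  intro a ha b hb
  rw [mem_inversions_simple.1 ha]
  exact (cubical_iff_commute hM hx hy).1 hxy _ ht b hb

/-- Holes in the link of the vertex `1` of the thickened Davis complex give rise to holes, of at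
most the same length, in the nerve. -/
theorem exists_isHole_nerve (hM : M.IsRightAngled) {n : ℕ} {c : ℕ → M.Group}
    (hc : IsHole Cubical n c) (h1 : ∀ i < n, Cubical 1 (c i)) :
    ∃ m d, m ≤ n ∧ IsHole M.Joined m d := by
  induction hμ : ∑ i ∈ Finset.range n, len (c i) using Nat.strong_induction_on
    generalizing n c with
  | _ N ih =>
  have h4 := hc.1
  have hsymm : ∀ v w : M.Group, Cubical v w → Cubical w v := fun v w h => h.symm hM
  by_cases hall : ∀ i < n, ∃ s, c i = M.simple s
  · have : Nonempty S := ⟨(hall 0 (by omega)).choose⟩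
    choose! s hs using hall
    refine ⟨n, s, le_rfl, h4, fun i j hij hj => ?_⟩
    rw [← hc.2 i j hij hj]
    have hi : i < n := hij.trans hj
    rw [cubical_iff_commute hM (h1 i hi) (h1 j hj), hs i hi, hs j hj, Joined, ← commute_iff hM]
    simp only [mem_inversions_simple, forall_eq]
  · push Not at hall
    obtain ⟨r, hr, hrs⟩ := hall
    obtain ⟨d, hd, hd0, hdc, hdμ⟩ := hc.rotate hsymm len hr
    have h1d : ∀ i < n, Cubical 1 (d i) := fun i hi => by
      obtain ⟨j, hj, hij⟩ := hdc i hi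
      exact hij ▸ h1 j hj
    -- As `d 0` and `d 2` are not adjacent, some generator `t` inverted by `d 0` fails to commute
    -- with an inversion of `d 2`. It is shorter than `d 0`, keeps both neighbours of `d 0` and
    -- misses `d 2`, so it can serve as a shortcut.
    have hnd : ¬ Cubical (d 0) (d 2) := by
      rw [hd.2 0 2 (by omega) (by omega)]
      omega
    rw [cubical_iff_commute hM (h1d 0 (by omega)) (h1d 2 (by omega))] at hnd
    push Not at hnd
    obtain ⟨a, ha, b, hb, hab⟩ := hnd
    obtain ⟨t, rfl⟩ := cubical_one_left.1 (h1d 0 (by omega)) ha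
    have h1t : Cubical 1 (M.simple t) := by
      rw [cubical_one_left]
      intro z hz
      rw [mem_inversions_simple.1 hz]
      exact ⟨t, rfl⟩
    have hlen : len (M.simple t) < len (d 0) := by
      have hl : len (M.simple t) = 1 := M.toCoxeterSystem.length_simple t
      have h0 : len (d 0) ≠ 0 := by
        intro h0
        rw [len, M.toCoxeterSystem.length_eq_zero_iff] at h0
        simp [h0] at ha
      have h2 : len (d 0) ≠ 1 := by
        intro h2
        rw [len, M.toCoxeterSystem.length_eq_one_iff] at h2
        obtain ⟨s, hs⟩ := h2
        exact hrs s (hd0 ▸ hs)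
      omega
    obtain ⟨m, e, hmn, he, hev, heμ⟩ := hd.shortcut len (x := M.simple t) hlen
      (Cubical.simple_left hM (h1d 0 (by omega)) (h1d 1 (by omega)) ha
        ((hd.2 0 1 (by omega) (by omega)).2 (by omega)))
      (Cubical.simple_left hM (h1d 0 (by omega)) (h1d _ (by omega)) ha
        ((hd.2 0 (n - 1) (by omega) (by omega)).2 (by omega)))
      (j := 2) (by omega) (by omega) (by
        rw [cubical_iff_commute hM h1t (h1d 2 (by omega))]
        intro h
        exact hab (h _ (mem_inversions_simple.2 rfl) b hb))
    obtain ⟨m', d', hm', hd'⟩ := ih _ (hμ ▸ hdμ ▸ heμ) he (fun i hi => by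
      rcases hev i hi with h | ⟨l, hl, h⟩
      · exact h ▸ h1t
      · exact h ▸ h1d l hl) rfl
    exact ⟨m', d', hm'.trans hmn, hd'⟩

/-- Holes in the thickened Davis complex give rise to holes, of at most the same length, in the
nerve. -/
theorem exists_isHole_nerve_of_isHole (hM : M.IsRightAngled) {n : ℕ} {c : ℕ → M.Group}
    (hc : IsHole Cubical n c) : ∃ m d, m ≤ n ∧ IsHole M.Joined m d := by
  induction hμ : ∑ i ∈ Finset.range n, len (c i) using Nat.strong_induction_on
    generalizing n c with
  | _ N ih =>
  have h4 := hc.1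
  have hsymm : ∀ v w : M.Group, Cubical v w → Cubical w v := fun v w h => h.symm hM
  obtain ⟨h, ⟨a, ⟨r, hr, rfl⟩, hrh⟩, hext⟩ := exists_extremal_wall hM
    (A := c '' Set.Iio n) ((Set.finite_Iio n).image c) (by
      by_contra hcon
      push Not at hcon
      refine hc.ne cubical_refl hsymm (i := 0) (j := 1) (by omega) (by omega) ?_
      rw [hcon _ ⟨0, by simp; omega, rfl⟩, hcon _ ⟨1, by simp; omega, rfl⟩])
  obtain ⟨d, hd, hd0, hdc, hdμ⟩ := hc.rotate hsymm len hr
  have hextd : ∀ i < n, h ∈ inversions (d i) → (d i)⁻¹ * h * d i ∈ Set.range M.simple := by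
    intro i hi
    obtain ⟨j, hj, hij⟩ := hdc i hi
    exact hij ▸ hext _ ⟨j, hj, rfl⟩
  rw [← hd0] at hrh
  obtain ⟨s, hs⟩ := hextd 0 (by omega) hrh
  have hfold : ∀ i < n, Cubical (d 0) (d i) → Cubical (h * d 0) (d i) := fun i hi =>
    Cubical.fold hM hs.symm hrh (hextd i hi)
  -- If the folded vertex sees the whole hole, translating it to `1` places the hole in the link of
  -- `1`. Otherwise it gives a shortcut of smaller total length.
  by_cases hall : ∀ i < n, Cubical (h * d 0) (d i)
  · obtain ⟨m, e, hm, he⟩ := exists_isHole_nerve hM (n := n) (c := fun i => (h * d 0)⁻¹ * d i)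
      ⟨h4, fun i j hij hj => by rw [cubical_mul_left]; exact hd.2 i j hij hj⟩ (fun i hi => by
        have := hall i hi
        rw [← cubical_mul_left (h * d 0)⁻¹] at this
        simpa only [inv_mul_cancel] using this)
    exact ⟨m, e, hm, he⟩
  · push Not at hall
    obtain ⟨j, hj, hnj⟩ := hall
    have hj0 : j ≠ 0 := by
      rintro rfl
      exact hnj (hfold 0 hj (cubical_refl _))
    obtain ⟨m, e, hmn, he, -, heμ⟩ := hd.shortcut len (len_mul_lt hrh)
      (hfold 1 (by omega) ((hd.2 0 1 (by omega) (by omega)).2 (by omega)))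
      (hfold _ (by omega) ((hd.2 0 (n - 1) (by omega) (by omega)).2 (by omega)))
      (j := j) (by omega) hj hnj
    obtain ⟨m', d', hm', hd'⟩ := ih _ (hμ ▸ hdμ ▸ heμ) he rfl
    exact ⟨m', d', hm'.trans hmn, hd'⟩

end CoxeterMatrix

/-! ### Large complexes and holes -/

namespace AbstractSimplicialComplex

variable {V : Type u} (K : AbstractSimplicialComplex V)

open Classical in
/-- Two vertices are related if they are equal or joined by an edge. -/
def Related (u v : V) : Prop := ({u, v} : Finset V) ∈ K.toPreAbstractSimplicialComplex

theorem singleton_mem' (v : V) : {v} ∈ K.toPreAbstractSimplicialComplex := K.singleton_mem v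

theorem related_refl (v : V) : K.Related v v := by
  classical
  simpa [Related] using K.singleton_mem' v

variable {K}

theorem Related.symm {u v : V} (h : K.Related u v) : K.Related v u := by
  classical
  unfold Related at *
  rwa [Finset.pair_comm]

end AbstractSimplicialComplex

namespace PreAbstractSimplicialComplex

variable {V : Type u} {K : PreAbstractSimplicialComplex V}

theorem mem_of_subset {s t : Finset V} (hs : s ∈ K) (hts : t ⊆ s) (ht : t.Nonempty) : t ∈ K :=
  (K.isRelLowerSet_faces hs).2 hts ht

theorem nonempty_of_mem {s : Finset V} (hs : s ∈ K) : s.Nonempty := (K.isRelLowerSet_faces hs).1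

theorem mem_link {σ τ : Finset V} :
    τ ∈ K.link σ ↔ τ ∈ K ∧ Disjoint τ σ ∧ (open Classical in τ ∪ σ) ∈ K := Iff.rfl

theorem IsFlag.mem_of_pairs (hK : K.IsFlag) {s : Finset V} (hs : s.Nonempty)
    (h : ∀ u ∈ s, ∀ v ∈ s, (open Classical in ({u, v} : Finset V)) ∈ K) : s ∈ K := by
  classical
  refine hK s hs (fun v hv => ?_) fun u hu v hv huv => ⟨huv, h u hu v hv⟩
  simpa using h v hv v hv

/-- In a flag complex a link is the full subcomplex on its vertices. This is why flagness and the
absence of short full cycles pass to links. -/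
theorem IsFlag.mem_link (hK : K.IsFlag) {σ s : Finset V} (hσ : σ ∈ K) (hs : s ∈ K)
    (h : ∀ v ∈ s, {v} ∈ K.link σ) : s ∈ K.link σ := by
  classical
  refine ⟨hs, ?_, hK.mem_of_pairs ((nonempty_of_mem hs).mono Finset.subset_union_left) ?_⟩
  · rw [Finset.disjoint_left]
    intro v hv
    simpa using (h v hv).2.1
  · have key : ∀ u ∈ s, ∀ v ∈ σ, ({u, v} : Finset V) ∈ K := by
      intro u hu v hv
      have h3 : {u} ∪ σ ∈ K := by convert (h u hu).2.2
      refine mem_of_subset h3 ?_ ⟨u, by simp⟩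
      intro x hx
      simp only [Finset.mem_insert, Finset.mem_singleton] at hx
      rcases hx with rfl | rfl <;> simp [hv]
    intro u hu v hv
    rw [Finset.mem_union] at hu hv
    rcases hu with hu | hu <;> rcases hv with hv | hv
    · exact mem_of_subset hs (by simp [Finset.insert_subset_iff, hu, hv]) ⟨u, by simp⟩
    · exact key u hu v hv
    · rw [Finset.pair_comm]; exact key v hv u hu
    · exact mem_of_subset hσ (by simp [Finset.insert_subset_iff, hu, hv]) ⟨u, by simp⟩

/-- Links in `k`-large complexes are `k`-large. -/
theorem IsLarge.isLocallyLarge {k : ℕ} (hK : K.IsLarge k) : K.IsLocallyLarge k := by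
  classical
  intro σ hσ
  refine ⟨fun s hs hv hadj => ?_, fun n hn hnk c hc => ?_⟩
  · refine hK.1.mem_link hσ (hK.1 s hs (fun v hvs => (hv v hvs).1) fun u hu v hv huv => ?_) hv
    exact ⟨huv, by convert (hadj u hu v hv huv).2.1⟩
  · refine hK.2 n hn hnk c ⟨hc.1, fun s hs => ?_⟩
    rw [← hc.2 s hs]
    refine ⟨fun h => hK.1.mem_link hσ h fun v hv => ?_, fun h => h.1⟩
    obtain ⟨i, rfl⟩ := hs hv
    exact (hc.2 {c i} (by simp)).2 (Or.inl ⟨i, rfl⟩)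

end PreAbstractSimplicialComplex

namespace AbstractSimplicialComplex

variable {V : Type u} {K : AbstractSimplicialComplex V}

theorem natCast_eq_succ_iff {n i j : ℕ} (hi : i < n) (hj : j < n) :
    (j : ZMod n) = i + 1 ↔ j = i + 1 ∨ (j = 0 ∧ i = n - 1) := by
  have : (j : ZMod n) = i + 1 ↔ (j : ZMod n) = (i + 1 : ℕ) := by push_cast; rfl
  rw [this, ZMod.natCast_eq_natCast_iff, Nat.ModEq, Nat.mod_eq_of_lt hj]
  rcases Nat.lt_or_ge (i + 1) n with h | h
  · rw [Nat.mod_eq_of_lt h]; omega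
  · obtain rfl : n = i + 1 := by omega
    rw [Nat.mod_self]; omega

theorem isHole_of_isFullCycle {n : ℕ} (hn : 4 ≤ n) {c : ZMod n → V}
    (hc : K.toPreAbstractSimplicialComplex.IsFullCycle n c) :
    IsHole K.Related n fun i => c i := by
  classical
  refine ⟨hn, fun i j hij hj => ?_⟩
  have hi : i < n := hij.trans hj
  have hne : (i : ZMod n) ≠ j := by
    rw [Ne, ZMod.natCast_eq_natCast_iff, Nat.ModEq, Nat.mod_eq_of_lt hj, Nat.mod_eq_of_lt hi]
    omega
  have hpair : ∀ a b x y : V, ({a, b} : Finset V) = {x, y} ↔ (a = x ∧ b = y) ∨ (a = y ∧ b = x) := by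
    intro a b x y
    rw [← Finset.coe_inj]
    simp only [Finset.coe_pair]
    exact Set.pair_eq_pair_iff
  have h1 : K.Related (c i) (c j) ↔ ((j : ZMod n) = i + 1 ∨ (i : ZMod n) = j + 1) := by
    have h2 := hc.2 {c i, c j} (by
      intro x hx
      simp only [Finset.coe_pair, Set.mem_insert_iff, Set.mem_singleton_iff] at hx
      rcases hx with rfl | rfl <;> simp)
    have h3 : K.Related (c i) (c j) ↔ _ := Iff.trans (by unfold Related; rfl) h2
    rw [h3]
    constructor
    · rintro (⟨a, ha⟩ | ⟨a, ha⟩)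
      · rw [← Finset.pair_eq_singleton (c a), hpair] at ha
        exact absurd (hc.1 (ha.elim (fun h => h.1.trans h.2.symm) fun h => h.1.trans h.2.symm)) hne
      · rw [hpair] at ha
        rcases ha with ⟨h5, h6⟩ | ⟨h5, h6⟩
        · left; rw [hc.1 h5, hc.1 h6]
        · right; rw [hc.1 h5, hc.1 h6]
    · rintro (h | h)
      · exact Or.inr ⟨i, by rw [h]⟩
      · exact Or.inr ⟨j, by rw [h, Finset.pair_comm]⟩
  rw [h1, natCast_eq_succ_iff hi hj, natCast_eq_succ_iff hj hi]
  omega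

/-- Flagness is not needed: a simplex on the hole has pairwise related vertices, and an induced
cycle of length at least 4 contains no triangle. -/
theorem isFullCycle_of_isHole {n : ℕ} {c : ℕ → V}
    (hc : IsHole K.Related n c) :
    K.toPreAbstractSimplicialComplex.IsFullCycle n fun i : ZMod n => c i.val := by
  classical
  have h4 := hc.1
  have : NeZero n := ⟨by omega⟩
  have hinj : ∀ i j, i < n → j < n → c i = c j → i = j := by
    intro i j hi hj h
    rcases lt_trichotomy i j with hlt | heq | hlt
    · exact absurd h (hc.ne K.related_refl (fun _ _ => Related.symm) hlt hj)
    · exact heq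
    · exact absurd h.symm (hc.ne K.related_refl (fun _ _ => Related.symm) hlt hi)
  have hadj : ∀ i j, i < n → j < n → (K.Related (c i) (c j) ↔
      j = i ∨ j = i + 1 ∨ i = j + 1 ∨ (i = 0 ∧ j = n - 1) ∨ (j = 0 ∧ i = n - 1)) := by
    intro i j hi hj
    rcases lt_trichotomy i j with hlt | rfl | hlt
    · rw [hc.2 i j hlt hj]; omega
    · simp [K.related_refl]
    · have : K.Related (c i) (c j) ↔ K.Related (c j) (c i) := ⟨Related.symm, Related.symm⟩
      rw [this, hc.2 j i hlt hi]; omega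
  have hsucc : ∀ i : ZMod n, (i + 1).val = if i.val + 1 < n then i.val + 1 else 0 := by
    intro i
    have h1 : (i : ZMod n) + 1 = ((i.val + 1 : ℕ) : ZMod n) := by simp
    rw [h1, ZMod.val_natCast]
    have := i.val_lt
    split_ifs with h
    · exact Nat.mod_eq_of_lt h
    · rw [show i.val + 1 = n by omega, Nat.mod_self]
  refine ⟨fun i j h => ZMod.val_injective n (hinj _ _ i.val_lt j.val_lt h), fun s hs => ?_⟩
  constructor
  · intro hsK
    have hrel : ∀ u ∈ s, ∀ v ∈ s, K.Related u v := fun u hu v hv =>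
      PreAbstractSimplicialComplex.mem_of_subset hsK
        (by simp [Finset.insert_subset_iff, hu, hv]) ⟨u, by simp⟩
    obtain ⟨a, ha⟩ := PreAbstractSimplicialComplex.nonempty_of_mem hsK
    obtain ⟨i, rfl⟩ := hs ha
    by_cases hsi : s = {c i.val}
    · exact Or.inl ⟨i, hsi⟩
    obtain ⟨b, hb, hbi⟩ : ∃ b ∈ s, b ≠ c i.val := by
      by_contra hcon
      push Not at hcon
      exact hsi (Finset.eq_singleton_iff_unique_mem.2 ⟨ha, hcon⟩)
    obtain ⟨j, rfl⟩ := hs hb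
    have hij : i.val ≠ j.val := fun h => hbi (by simp [h])
    have h1 := (hadj _ _ i.val_lt j.val_lt).1 (hrel _ ha _ hb)
    have hsij : s = {c i.val, c j.val} := by
      ext x
      simp only [Finset.mem_insert, Finset.mem_singleton]
      constructor
      · intro hx
        obtain ⟨l, rfl⟩ := hs hx
        have h2 := (hadj _ _ i.val_lt l.val_lt).1 (hrel _ ha _ hx)
        have h3 := (hadj _ _ j.val_lt l.val_lt).1 (hrel _ hb _ hx)
        have hi := i.val_lt
        have hj := j.val_lt
        have hl := l.val_lt
        have : l.val = i.val ∨ l.val = j.val := by omega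
        rcases this with h | h
        · exact Or.inl (by simp [h])
        · exact Or.inr (by simp [h])
      · rintro (rfl | rfl) <;> assumption
    have hi := i.val_lt
    have hj := j.val_lt
    have h5 : j.val = (i + 1).val ∨ i.val = (j + 1).val := by
      rw [hsucc, hsucc]
      split_ifs <;> omega
    rcases h5 with h5 | h5
    · exact Or.inr ⟨i, by rw [hsij, h5]⟩
    · exact Or.inr ⟨j, by rw [hsij, h5, Finset.pair_comm]⟩
  · rintro (⟨i, rfl⟩ | ⟨i, rfl⟩)
    · exact K.singleton_mem' _
    · refine (hadj _ _ i.val_lt (i + 1).val_lt).2 ?_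
      have := i.val_lt
      rw [hsucc]
      split_ifs <;> omega

/-- A complex is `k`-large iff it is flag and has no holes of length less than `k`. -/
theorem isLarge_iff {k : ℕ} : K.toPreAbstractSimplicialComplex.IsLarge k ↔
    K.toPreAbstractSimplicialComplex.IsFlag ∧ ∀ n < k, ∀ c, ¬ IsHole K.Related n c := by
  refine and_congr_right fun _ => ⟨fun h n hn c hc => ?_, fun h n hn hnk c hc => ?_⟩
  · exact h n hc.1 hn _ (isFullCycle_of_isHole hc)
  · exact h n hnk _ (isHole_of_isFullCycle hn hc)

end AbstractSimplicialComplex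

/-! ### Simple connectedness of dismantlable complexes -/

namespace PreAbstractSimplicialComplex

variable {V : Type u} {K : PreAbstractSimplicialComplex V}

/-- The part of the geometric realization spanned by the vertices in `A`. -/
def realizationOn (K : PreAbstractSimplicialComplex V) (A : Finset V) : Set (V → ℝ) :=
  {x | x ∈ K.realization ∧ ∀ v ∉ A, x v = 0}

theorem mem_realizationOn_iff {A : Finset V} {x : V → ℝ} :
    x ∈ K.realizationOn A ↔ (∀ v, 0 ≤ x v) ∧ ∑ v ∈ A, x v = 1 ∧
      ∃ s ∈ K, s ⊆ A ∧ ∀ v ∉ s, x v = 0 := by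
  classical
  constructor
  · rintro ⟨⟨h0, s, hs, hs0, hs1⟩, hA⟩
    have e : ∑ v ∈ s ∩ A, x v = 1 := by
      rw [← hs1]
      refine Finset.sum_subset Finset.inter_subset_left fun v hv hvA => hA v fun h => hvA ?_
      exact Finset.mem_inter.2 ⟨hv, h⟩
    have hz : ∀ v ∉ s ∩ A, x v = 0 := fun v hv => by
      by_cases h : v ∈ s
      · exact hA v fun h' => hv (Finset.mem_inter.2 ⟨h, h'⟩)
      · exact hs0 v h
    refine ⟨h0, ?_, s ∩ A, mem_of_subset hs Finset.inter_subset_left ?_, Finset.inter_subset_right, hz⟩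
    · rw [← e]
      exact (Finset.sum_subset Finset.inter_subset_right fun v _ hv => hz v hv).symm
    · rw [Finset.nonempty_iff_ne_empty]
      intro h
      simp [h] at e
  · rintro ⟨h0, h1, s, hs, hsA, hz⟩
    refine ⟨⟨h0, s, hs, hz, ?_⟩, fun v hv => hz v fun h => hv (hsA h)⟩
    rw [← h1]
    exact Finset.sum_subset hsA fun v _ hv => hz v hv

open Classical in
/-- The affine extension of a map `f` on vertices. -/
noncomputable def push (A : Finset V) (f : V → V) (x : V → ℝ) (v : V) : ℝ :=
  ∑ a ∈ A with f a = v, x a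

theorem continuous_push (A : Finset V) (f : V → V) : Continuous (push A f) :=
  continuous_pi fun _ => continuous_finsetSum _ fun a _ => continuous_apply a

theorem push_nonneg {A : Finset V} {f : V → V} {x : V → ℝ} (hx : ∀ v, 0 ≤ x v) (v : V) :
    0 ≤ push A f x v := Finset.sum_nonneg fun a _ => hx a

theorem sum_push {A B : Finset V} {f : V → V} (hf : ∀ a ∈ A, f a ∈ B) (x : V → ℝ) :
    ∑ v ∈ B, push A f x v = ∑ a ∈ A, x a := by
  classical
  exact Finset.sum_fiberwise_of_maps_to hf x

theorem push_eq_zero {A s : Finset V} {f : V → V} {x : V → ℝ} (hx : ∀ v ∉ s, x v = 0) {v : V}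
    (hv : ∀ a ∈ s, f a ≠ v) : push A f x v = 0 := by
  classical
  refine Finset.sum_eq_zero fun a ha => hx a fun has => hv a has ?_
  exact (Finset.mem_filter.1 ha).2

theorem push_eq_self {A B : Finset V} {f : V → V} {x : V → ℝ} (hBA : B ⊆ A)
    (hf : ∀ b ∈ B, f b = b) (hx : ∀ v ∉ B, x v = 0) : push A f x = x := by
  classical
  funext v
  rw [push, Finset.sum_filter]
  have : ∀ a ∈ A, (if f a = v then x a else 0) = if a = v then x a else 0 := by
    intro a _
    by_cases ha : a ∈ B
    · rw [hf a ha]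
    · simp [hx a ha]
  rw [Finset.sum_congr rfl this, Finset.sum_ite_eq']
  split_ifs with h
  · rfl
  · exact (hx v fun hB => h (hBA hB)).symm

/-- A retraction `f` of the vertex set `A` onto `B` such that `s ∪ f s` is a simplex for every
simplex `s` on `A` does not change the homotopy type of the subcomplex spanned by `A`. -/
theorem contractibleSpace_realizationOn {A B : Finset V} {f : V → V} (hBA : B ⊆ A)
    (hfA : ∀ a ∈ A, f a ∈ B) (hfB : ∀ b ∈ B, f b = b)
    (hf : ∀ s ∈ K, s ⊆ A → (open Classical in s ∪ s.image f) ∈ K)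
    (hB : ContractibleSpace (K.realizationOn B)) : ContractibleSpace (K.realizationOn A) := by
  classical
  have hpush : ∀ x ∈ K.realizationOn A, push A f x ∈ K.realizationOn B := by
    intro x hx
    obtain ⟨h0, h1, s, hs, hsA, hz⟩ := mem_realizationOn_iff.1 hx
    refine mem_realizationOn_iff.2 ⟨push_nonneg h0, by rw [sum_push hfA, h1], s.image f,
      mem_of_subset (hf s hs hsA) Finset.subset_union_right ((nonempty_of_mem hs).image f), ?_, ?_⟩
    · intro v hv
      obtain ⟨a, ha, rfl⟩ := Finset.mem_image.1 hv
      exact hfA a (hsA ha)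
    · intro v hv
      exact push_eq_zero hz fun a ha hav => hv (Finset.mem_image.2 ⟨a, ha, hav⟩)
  -- The straight-line homotopy stays in the complex because `x` and its image both lie in the
  -- simplex `s ∪ f s`.
  have hline : ∀ x ∈ K.realizationOn A, ∀ t ∈ Set.Icc (0 : ℝ) 1,
      (1 - t) • push A f x + t • x ∈ K.realizationOn A := by
    intro x hx t ht
    obtain ⟨h0, h1, s, hs, hsA, hz⟩ := mem_realizationOn_iff.1 hx
    refine mem_realizationOn_iff.2 ⟨fun v => ?_, ?_, _, hf s hs hsA, ?_, fun v hv => ?_⟩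
    · have h2 : 0 ≤ push A f x v := push_nonneg h0 v
      have h3 := h0 v
      have h4 : 0 ≤ 1 - t := by linarith [ht.2]
      have h5 := ht.1
      simp only [Pi.add_apply, Pi.smul_apply, smul_eq_mul]
      positivity
    · simp only [Pi.add_apply, Pi.smul_apply, smul_eq_mul, Finset.sum_add_distrib,
        ← Finset.mul_sum]
      rw [sum_push (B := A) (fun a ha => hBA (hfA a ha)), h1]
      ring
    · intro v hv
      rcases Finset.mem_union.1 hv with hv | hv
      · exact hsA hv
      · obtain ⟨a, ha, rfl⟩ := Finset.mem_image.1 hv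
        exact hBA (hfA a (hsA ha))
    · rw [Finset.mem_union, not_or] at hv
      have h2 : push A f x v = 0 :=
        push_eq_zero hz fun a ha hav => hv.2 (Finset.mem_image.2 ⟨a, ha, hav⟩)
      simp [h2, hz v hv.1]
  have hincl : ∀ x ∈ K.realizationOn B, x ∈ K.realizationOn A := fun x hx =>
    ⟨hx.1, fun v hv => hx.2 v fun h => hv (hBA h)⟩
  let F : C(K.realizationOn A, K.realizationOn B) :=
    ⟨fun x => ⟨push A f x, hpush x x.2⟩,
      ((continuous_push A f).comp continuous_subtype_val).subtype_mk _⟩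
  let G : C(K.realizationOn B, K.realizationOn A) :=
    ⟨fun x => ⟨x, hincl x x.2⟩, continuous_subtype_val.subtype_mk _⟩
  let e : ContinuousMap.HomotopyEquiv (K.realizationOn A) (K.realizationOn B) :=
    { toFun := F
      invFun := G
      left_inv := ⟨
        { toFun := fun p => ⟨(1 - (p.1 : ℝ)) • push A f p.2 + (p.1 : ℝ) • (p.2 : V → ℝ),
            hline p.2 p.2.2 p.1 p.1.2⟩
          continuous_toFun := by
            refine Continuous.subtype_mk ?_ _
            have h1 : Continuous fun p : unitInterval × K.realizationOn A => (p.1 : ℝ) :=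
              continuous_subtype_val.comp continuous_fst
            have h2 : Continuous fun p : unitInterval × K.realizationOn A => (p.2 : V → ℝ) :=
              continuous_subtype_val.comp continuous_snd
            exact ((continuous_const.sub h1).smul ((continuous_push A f).comp h2)).add (h1.smul h2)
          map_zero_left := fun x => by
            apply Subtype.ext
            simp [F, G]
          map_one_left := fun x => by
            apply Subtype.ext
            simp }⟩
      right_inv := by
        have : F.comp G = ContinuousMap.id _ := by
          ext1 x
          exact Subtype.ext (push_eq_self hBA hfB x.2.2)
        rw [this] }
  exact e.contractibleSpace

/-- The open vertex stars cover the realization, so a compact image meets it within finitely many of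
them; local finiteness bounds the vertices involved. -/
theorem exists_finset_support {A : Type*} [TopologicalSpace A] [CompactSpace A]
    (hfin : ∀ v, {w | ∃ s ∈ K, v ∈ s ∧ w ∈ s}.Finite) (p : A → K.realization)
    (hp : Continuous p) : ∃ B : Finset V, ∀ a, ∀ v ∉ B, (p a).1 v = 0 := by
  classical
  have hopen : ∀ v, IsOpen {a | 0 < (p a).1 v} := fun v =>
    isOpen_lt continuous_const ((continuous_apply v).comp (continuous_subtype_val.comp hp))
  have hcov : (Set.univ : Set A) ⊆ ⋃ v, {a | 0 < (p a).1 v} := by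
    intro a _
    obtain ⟨h0, s, hs, hz, h1⟩ := (p a).2
    by_contra hcon
    simp only [Set.mem_iUnion, Set.mem_ofPred_eq, not_exists, not_lt] at hcon
    have : ∑ v ∈ s, (p a).1 v = 0 :=
      Finset.sum_eq_zero fun v _ => le_antisymm (hcon v) (h0 v)
    rw [this] at h1
    exact zero_ne_one h1
  obtain ⟨b, hb⟩ := isCompact_univ.elim_finite_subcover _ hopen hcov
  refine ⟨b.biUnion fun v => (hfin v).toFinset, fun a w hw => ?_⟩
  have ha := hb (Set.mem_univ a)
  simp only [Set.mem_iUnion, Set.mem_ofPred_eq] at ha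
  obtain ⟨v, hvb, hv⟩ := ha
  obtain ⟨h0, s, hs, hz, h1⟩ := (p a).2
  refine hz w fun hws => hw ?_
  refine Finset.mem_biUnion.2 ⟨v, hvb, (hfin v).mem_toFinset.2 ⟨s, hs, ?_, hws⟩⟩
  by_contra hvs
  exact hv.ne' (hz v hvs)

/-- A locally finite complex that is exhausted by finite contractible subcomplexes is simply
connected. -/
theorem simplyConnectedSpace_realization
    (hfin : ∀ v, {w | ∃ s ∈ K, v ∈ s ∧ w ∈ s}.Finite)
    (hA : ∀ F : Finset V, ∃ A, F ⊆ A ∧ ContractibleSpace (K.realizationOn A)) :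
    SimplyConnectedSpace K.realization := by
  classical
  let incl : ∀ A : Finset V, C(K.realizationOn A, K.realization) := fun A =>
    ⟨fun x => ⟨x.1, x.2.1⟩, continuous_subtype_val.subtype_mk _⟩
  rw [simply_connected_iff_paths_homotopic']
  constructor
  · obtain ⟨A, -, hc⟩ := hA ∅
    obtain ⟨x0⟩ : Nonempty (K.realizationOn A) := inferInstance
    refine ⟨⟨incl A x0⟩, fun x y => ?_⟩
    obtain ⟨hx0, s, hs, hsz, hs1⟩ := x.2
    obtain ⟨hy0, t, ht, htz, ht1⟩ := y.2
    obtain ⟨B, hB, hcB⟩ := hA (s ∪ t)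
    let x' : K.realizationOn B :=
      ⟨x.1, x.2, fun v hv => hsz v fun h => hv (hB (Finset.mem_union_left _ h))⟩
    let y' : K.realizationOn B :=
      ⟨y.1, y.2, fun v hv => htz v fun h => hv (hB (Finset.mem_union_right _ h))⟩
    exact ⟨(PathConnectedSpace.somePath x' y').map (incl B).continuous⟩
  · intro x y p q
    obtain ⟨B, hB⟩ := exists_finset_support hfin p p.continuous
    obtain ⟨C, hC⟩ := exists_finset_support hfin q q.continuous
    obtain ⟨A, hBCA, hcA⟩ := hA (B ∪ C)
    have hpA : ∀ t, (p t).1 ∈ K.realizationOn A := fun t =>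
      ⟨(p t).2, fun v hv => hB t v fun h => hv (hBCA (Finset.mem_union_left _ h))⟩
    have hqA : ∀ t, (q t).1 ∈ K.realizationOn A := fun t =>
      ⟨(q t).2, fun v hv => hC t v fun h => hv (hBCA (Finset.mem_union_right _ h))⟩
    have hx : x.1 ∈ K.realizationOn A := by simpa using hpA 0
    have hy : y.1 ∈ K.realizationOn A := by simpa using hpA 1
    let p' : Path (⟨x.1, hx⟩ : K.realizationOn A) ⟨y.1, hy⟩ :=
      { toFun := fun t => ⟨(p t).1, hpA t⟩
        continuous_toFun := (continuous_subtype_val.comp p.continuous).subtype_mk _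
        source' := by simp
        target' := by simp }
    let q' : Path (⟨x.1, hx⟩ : K.realizationOn A) ⟨y.1, hy⟩ :=
      { toFun := fun t => ⟨(q t).1, hqA t⟩
        continuous_toFun := (continuous_subtype_val.comp q.continuous).subtype_mk _
        source' := by simp
        target' := by simp }
    exact (SimplyConnectedSpace.paths_homotopic p' q').map (incl A)

end PreAbstractSimplicialComplex

/-! ### The thickened Davis complex: largeness, simple connectedness, group action -/

namespace CoxeterMatrix

variable {S : Type u} {M : CoxeterMatrix S}

theorem related_davisThickening (hM : M.IsRightAngled) {v w : M.Group} :
    M.davisThickening.Related v w ↔ Cubical v w := by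
  classical
  have h : M.davisThickening.Related v w ↔ _ := mem_davisThickening_iff hM (P := {v, w})
  rw [h]
  constructor
  · exact fun h => h.2 v (by simp) w (by simp)
  · intro h
    refine ⟨⟨v, by simp⟩, fun a ha b hb => ?_⟩
    simp only [Finset.mem_insert, Finset.mem_singleton] at ha hb
    rcases ha with rfl | rfl <;> rcases hb with rfl | rfl
    exacts [cubical_refl _, h, h.symm hM, cubical_refl _]

theorem isFlag_davisThickening (hM : M.IsRightAngled) :
    M.davisThickening.toPreAbstractSimplicialComplex.IsFlag := by
  intro s hs _ hadj
  refine (mem_davisThickening_iff hM).2 ⟨hs, fun v hv w hw => ?_⟩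
  by_cases hvw : v = w
  · exact hvw ▸ cubical_refl v
  · exact (related_davisThickening hM).1 (hadj v hv w hw hvw).2

theorem mem_nerve_iff (hM : M.IsRightAngled) {T : Finset S} :
    T ∈ M.nerve.toPreAbstractSimplicialComplex ↔
      T.Nonempty ∧ ∀ s ∈ T, ∀ t ∈ T, M s t ≠ 0 := by
  rw [← isSpherical_iff hM]
  rfl

theorem related_nerve (hM : M.IsRightAngled) {s t : S} :
    M.nerve.Related s t ↔ M.Joined s t := by
  classical
  have h : M.nerve.Related s t ↔ _ := mem_nerve_iff hM (T := {s, t})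
  rw [h]
  constructor
  · exact fun h => h.2 s (by simp) t (by simp)
  · intro h
    refine ⟨⟨s, by simp⟩, fun a ha b hb => ?_⟩
    simp only [Finset.mem_insert, Finset.mem_singleton] at ha hb
    have h' : M t s ≠ 0 := by rw [M.symmetric]; exact h
    rcases ha with rfl | rfl <;> rcases hb with rfl | rfl
    · simp
    · exact h
    · exact h'
    · simp

theorem not_isHole_cubical (hM : M.IsRightAngled) {k : ℕ}
    (hk : M.nerve.toPreAbstractSimplicialComplex.IsLarge k) {n : ℕ} (hn : n < k)
    (c : ℕ → M.Group) : ¬ IsHole Cubical n c := by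
  intro hc
  obtain ⟨m, d, hm, hd⟩ := exists_isHole_nerve_of_isHole hM hc
  have e : M.Joined = M.nerve.Related := by
    funext s t
    exact propext (related_nerve hM).symm
  exact (AbstractSimplicialComplex.isLarge_iff.1 hk).2 m (hm.trans_lt hn) d (e ▸ hd)

/-- The thickened Davis complex of a right-angled Coxeter system with `k`-large nerve is
`k`-large. -/
theorem isLarge_davisThickening (hM : M.IsRightAngled) {k : ℕ}
    (hk : M.nerve.toPreAbstractSimplicialComplex.IsLarge k) :
    M.davisThickening.toPreAbstractSimplicialComplex.IsLarge k := by
  have e : M.davisThickening.Related = Cubical := by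
    funext s t
    exact propext (related_davisThickening hM)
  exact AbstractSimplicialComplex.isLarge_iff.2
    ⟨isFlag_davisThickening hM, fun n hn c hc => not_isHole_cubical hM hk hn c (e ▸ hc)⟩

/-- Fold the points beyond an extremal wall back across it and induct on the cardinality. The
closure hypothesis on `A` keeps the folded points in `A`; it holds for balls around `1` in the word
length. -/
theorem contractibleSpace_realizationOn_davis (hM : M.IsRightAngled) (A : Finset M.Group)
    (h1 : 1 ∈ A) (hA : ∀ a ∈ A, ∀ h ∈ inversions a,
      a⁻¹ * h * a ∈ Set.range M.simple → h * a ∈ A) :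
    ContractibleSpace (M.davisThickening.toPreAbstractSimplicialComplex.realizationOn A) := by
  classical
  induction hn : A.card using Nat.strong_induction_on generalizing A with
  | _ n ih =>
  by_cases hall : ∀ a ∈ A, a = 1
  · obtain rfl : A = {1} := Finset.eq_singleton_iff_unique_mem.2 ⟨h1, hall⟩
    have hval : ∀ x ∈ M.davisThickening.toPreAbstractSimplicialComplex.realizationOn {1},
        x = Pi.single 1 1 := by
      intro x hx
      have h2 := (PreAbstractSimplicialComplex.mem_realizationOn_iff.1 hx).2.1
      rw [Finset.sum_singleton] at h2
      funext v
      by_cases hv : v = 1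
      · subst hv; rw [h2, Pi.single_eq_same]
      · rw [hx.2 v (by simpa using hv), Pi.single_eq_of_ne hv]
    have : Subsingleton (M.davisThickening.toPreAbstractSimplicialComplex.realizationOn {1}) :=
      ⟨fun x y => Subtype.ext ((hval x x.2).trans (hval y y.2).symm)⟩
    have : Nonempty (M.davisThickening.toPreAbstractSimplicialComplex.realizationOn {1}) := by
      refine ⟨⟨Pi.single 1 1, PreAbstractSimplicialComplex.mem_realizationOn_iff.2
        ⟨fun v => ?_, by simp, {1}, M.davisThickening.singleton_mem' 1, le_rfl, fun v hv => ?_⟩⟩⟩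
      · by_cases hv : v = 1
        · subst hv; simp
        · rw [Pi.single_eq_of_ne hv]
      · exact Pi.single_eq_of_ne (by simpa using hv) _
    infer_instance
  · push Not at hall
    obtain ⟨h, ⟨a, haA, ha⟩, hext⟩ := exists_extremal_wall hM A.finite_toSet hall
    set f : M.Group → M.Group := fun v => if h ∈ inversions v then h * v else v with hf
    have hfold : ∀ v ∈ A, ∀ w ∈ A, Cubical v w → Cubical (f v) w := by
      intro v hv w hw hvw
      by_cases hh : h ∈ inversions v
      · obtain ⟨s, hs⟩ := hext v hv hh
        simp only [hf, hh, if_true]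
        exact Cubical.fold hM hs.symm hh (hext w hw) hvw
      · simpa only [hf, hh, if_false] using hvw
    have hfB : ∀ v ∈ A, f v ∈ A.filter fun v => h ∉ inversions v := by
      intro v hv
      rw [Finset.mem_filter]
      by_cases hh : h ∈ inversions v
      · obtain ⟨s, hs⟩ := hext v hv hh
        simp only [hf, hh, if_true]
        refine ⟨hA v hv h hh ⟨s, hs⟩, ?_⟩
        rw [mem_inversions_reflection_mul hM hs.symm]
        simp [hh, Xor]
      · simp only [hf, hh, if_false]
        exact ⟨hv, not_false⟩
    refine PreAbstractSimplicialComplex.contractibleSpace_realizationOn (f := f)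
      (Finset.filter_subset (fun v => h ∉ inversions v) A) hfB ?_ ?_ ?_
    · intro b hb
      simp only [hf, (Finset.mem_filter.1 hb).2, if_false]
    · intro s hs hsA
      obtain ⟨hsne, hsp⟩ := (mem_davisThickening_iff hM).1 hs
      refine (mem_davisThickening_iff hM).2 ⟨hsne.mono Finset.subset_union_left, ?_⟩
      have hfA : ∀ v ∈ s, f v ∈ A := fun v hv => (Finset.mem_filter.1 (hfB v (hsA hv))).1
      have hsf : ∀ v ∈ s, ∀ w ∈ s, Cubical v (f w) := fun v hv w hw =>
        (hfold w (hsA hw) v (hsA hv) (hsp w hw v hv)).symm hM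
      intro v hv w hw
      rcases Finset.mem_union.1 hv with hv | hv <;> rcases Finset.mem_union.1 hw with hw | hw
      · exact hsp v hv w hw
      · obtain ⟨w, hw', rfl⟩ := Finset.mem_image.1 hw
        exact hsf v hv w hw'
      · obtain ⟨v, hv', rfl⟩ := Finset.mem_image.1 hv
        exact (hsf w hw v hv').symm hM
      · obtain ⟨v, hv', rfl⟩ := Finset.mem_image.1 hv
        obtain ⟨w, hw', rfl⟩ := Finset.mem_image.1 hw
        -- Fold one argument at a time: the folded `w` is still in `A`, so the wall is extremal for
        -- it as well.
        exact hfold v (hsA hv') _ (hfA w hw') (hsf v hv' w hw')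
    · refine ih _ ?_ _ ?_ ?_ rfl
      · rw [← hn]
        refine Finset.card_lt_card (Finset.filter_ssubset.2 ⟨a, haA, ?_⟩)
        simpa using ha
      · simp [h1]
      · intro b hb g hg hgs
        rw [Finset.mem_filter] at hb ⊢
        refine ⟨hA b hb.1 g hg hgs, ?_⟩
        obtain ⟨s, hs⟩ := hgs
        rw [mem_inversions_reflection_mul hM hs.symm]
        rintro (hx | hx)
        · exact hb.2 hx.1
        · exact hb.2 (hx.1 ▸ hg)

theorem finite_cubical [Finite S] (hM : M.IsRightAngled) (v : M.Group) :
    {w | Cubical v w}.Finite := by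
  refine Set.Finite.of_injOn (f := fun w => inversions (v⁻¹ * w))
    (t := 𝒫 (Set.range M.simple)) (fun w hw => hw) ?_ (Set.finite_range _).finite_subsets
  exact fun x _ y _ hxy => mul_left_cancel (inversions_injective hM hxy)

theorem finite_len_le [Finite S] (n : ℕ) : {w : M.Group | len w ≤ n}.Finite := by
  refine ((List.finite_length_le S n).image M.toCoxeterSystem.wordProd).subset fun w hw => ?_
  obtain ⟨ω, hω, rfl⟩ := M.toCoxeterSystem.exists_isReduced w
  exact ⟨ω, hω.eq.symm.trans_le hw, rfl⟩

theorem simplyConnectedSpace_davisThickening [Finite S] (hM : M.IsRightAngled) :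
    SimplyConnectedSpace M.davisThickening.toPreAbstractSimplicialComplex.realization := by
  classical
  refine PreAbstractSimplicialComplex.simplyConnectedSpace_realization (fun v => ?_) fun F => ?_
  · refine (finite_cubical hM v).subset ?_
    rintro w ⟨s, hs, hv, hw⟩
    exact ((mem_davisThickening_iff hM).1 hs).2 v hv w hw
  · let n := F.sup len
    refine ⟨(finite_len_le n).toFinset, fun w hw => ?_,
      contractibleSpace_realizationOn_davis hM _ ?_ ?_⟩
    · rw [Set.Finite.mem_toFinset]
      exact Finset.le_sup (f := len) hw
    · rw [Set.Finite.mem_toFinset]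
      exact M.toCoxeterSystem.length_one.trans_le (Nat.zero_le n)
    · intro a ha h hh _
      rw [Set.Finite.mem_toFinset] at ha ⊢
      exact (len_mul_lt hh).le.trans ha

/-- The action on vertices is free, so `g` is determined by the image of one vertex of a simplex.
Every simplex can be translated into the finite set of vertices sharing a cube with `1`. -/
theorem actsGeometrically_davisThickening [Finite S] (hM : M.IsRightAngled) :
    ActsGeometrically M.Group M.davisThickening := by
  classical
  have hmap : ∀ (g : M.Group) (s : Finset M.Group), s ∈ M.davisThickening →
      s.map (MulAction.toPerm g).toEmbedding ∈ M.davisThickening := by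
    intro g s hs
    obtain ⟨hne, hp⟩ := (mem_davisThickening_iff hM).1 hs
    refine (mem_davisThickening_iff hM).2 ⟨hne.map, fun v hv w hw => ?_⟩
    obtain ⟨v, hv', rfl⟩ := Finset.mem_map.1 hv
    obtain ⟨w, hw', rfl⟩ := Finset.mem_map.1 hw
    exact (cubical_mul_left g v w).2 (hp v hv' w hw')
  refine ⟨hmap, fun s hs => ?_, ?_⟩
  · obtain ⟨⟨a, ha⟩, -⟩ := (mem_davisThickening_iff hM).1 hs
    refine (s.finite_toSet.image fun p => p * a⁻¹).subset fun g hg => ?_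
    have hg' : s.map (MulAction.toPerm g).toEmbedding = s := hg
    have : g * a ∈ s := by
      rw [← hg']
      exact Finset.mem_map.2 ⟨a, ha, rfl⟩
    exact ⟨g * a, this, mul_inv_cancel_right g a⟩
  · refine ⟨{t | (t : Set M.Group) ⊆ {w | Cubical 1 w}}, ?_, fun s hs => ?_⟩
    · refine ((finite_cubical hM 1).toFinset.powerset.finite_toSet).subset fun t ht => ?_
      rw [Finset.mem_coe, Finset.mem_powerset]
      intro w hw
      rw [Set.Finite.mem_toFinset]
      exact ht hw
    · obtain ⟨⟨a, ha⟩, hp⟩ := (mem_davisThickening_iff hM).1 hs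
      refine ⟨s.map (MulAction.toPerm a⁻¹).toEmbedding, fun w hw => ?_, a, ?_⟩
      · obtain ⟨w, hw', rfl⟩ := Finset.mem_map.1 hw
        have := (cubical_mul_left a⁻¹ a w).2 (hp a ha w hw')
        rwa [inv_mul_cancel] at this
      · ext w
        simp

theorem isSystolicGroup [Finite S] (hM : M.IsRightAngled) {k : ℕ}
    (hk : M.nerve.toPreAbstractSimplicialComplex.IsLarge k) : IsSystolicGroup k M.Group :=
  ⟨M.Group, inferInstance, M.davisThickening,
    ⟨isFlag_davisThickening hM, simplyConnectedSpace_davisThickening hM,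
      (isLarge_davisThickening hM hk).isLocallyLarge⟩,
    actsGeometrically_davisThickening hM⟩

/-! ### Quotients with large minimal displacement -/

/-- The form in which the displacement bound is used: a path of fewer than `k` steps, possibly
stationary, cannot join a vertex to a different `H`-translate. -/
theorem eq_one_of_path (hM : M.IsRightAngled) {H : Subgroup M.Group} {k : ℕ}
    (hH : (k : ℕ∞) ≤ M.minDisplacement H) {n : ℕ} (hn : n < k) {h : M.Group} (hh : h ∈ H)
    (c : ℕ → M.Group) (hc : ∀ i < n, Cubical (c i) (c (i + 1))) (hcn : c n = h * c 0) : h = 1 := by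
  by_contra h1
  have hd : ∀ i ≤ n, M.davisThickening.oneSkeleton.edist (c 0) (c i) ≤ i := by
    intro i
    induction i with
    | zero => simp
    | succ i ih =>
      intro hi
      refine (SimpleGraph.edist_triangle (v := c i)).trans ((add_le_add (ih (by omega)) ?_).trans_eq
        (Nat.cast_succ i).symm)
      by_cases he : c i = c (i + 1)
      · rw [he]; simp
      · have hadj : M.davisThickening.oneSkeleton.Adj (c i) (c (i + 1)) :=
          ⟨he, (related_davisThickening hM).2 (hc i hi)⟩
        exact (SimpleGraph.edist_eq_one_iff_adj.2 hadj).le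
  have h2 : M.minDisplacement H ≤ M.davisThickening.oneSkeleton.edist (c 0) (h * c 0) :=
    (iInf_le _ (c 0)).trans ((iInf_le _ h).trans ((iInf_le _ hh).trans (iInf_le _ h1)))
  have h3 := hH.trans (h2.trans (hcn ▸ hd n le_rfl))
  exact absurd (Nat.cast_le.1 h3) (by omega)

/-- The projection to the orbit space. -/
def toQuotient (H : Subgroup M.Group) (w : M.Group) : M.quotientVertices H := Quotient.mk _ w

theorem toQuotient_eq_iff {H : Subgroup M.Group} {v w : M.Group} :
    toQuotient H v = toQuotient H w ↔ ∃ h ∈ H, v = h * w := by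
  unfold toQuotient
  rw [Quotient.eq, MulAction.orbitRel_apply, MulAction.mem_orbit_iff]
  constructor
  · rintro ⟨h, rfl⟩
    exact ⟨h, h.2, rfl⟩
  · rintro ⟨h, hh, rfl⟩
    exact ⟨⟨h, hh⟩, rfl⟩

theorem toQuotient_surjective (H : Subgroup M.Group) : Function.Surjective (toQuotient H) :=
  Quotient.mk_surjective

theorem mem_quotientThickening_iff {H : Subgroup M.Group} {s : Finset (M.quotientVertices H)} :
    s ∈ (M.quotientThickening H).toPreAbstractSimplicialComplex ↔
      s.Nonempty ∧ ∃ c ∈ M.davisCubes, (s : Set (M.quotientVertices H)) ⊆ toQuotient H '' c := by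
  constructor
  · rintro ⟨hne, _, ⟨c, hc, rfl⟩, hs⟩
    exact ⟨hne, c, hc, hs⟩
  · rintro ⟨hne, c, hc, hs⟩
    exact ⟨hne, _, ⟨c, hc, rfl⟩, hs⟩

theorem related_quotientThickening (hM : M.IsRightAngled) {H : Subgroup M.Group} {v w : M.Group}
    (h : Cubical v w) : (M.quotientThickening H).Related (toQuotient H v) (toQuotient H w) := by
  classical
  obtain ⟨-, c, hc, hs⟩ := (related_davisThickening hM).2 h
  refine mem_quotientThickening_iff.2 ⟨⟨toQuotient H v, by simp⟩, c, hc, fun x hx => ?_⟩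
  simp only [Finset.coe_pair, Set.mem_insert_iff, Set.mem_singleton_iff] at hx
  rcases hx with rfl | rfl
  · exact ⟨v, hs (by simp), rfl⟩
  · exact ⟨w, hs (by simp), rfl⟩

/-- Path lifting for one edge: a cube realizing the edge downstairs is translated by `H` so as to
contain the prescribed lift `v`. -/
theorem exists_lift_of_related (hM : M.IsRightAngled) {H : Subgroup M.Group} {v : M.Group}
    {y : M.quotientVertices H} (h : (M.quotientThickening H).Related (toQuotient H v) y) :
    ∃ w, toQuotient H w = y ∧ Cubical v w := by
  classical
  obtain ⟨-, c, hc, hs⟩ := mem_quotientThickening_iff.1 h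
  obtain ⟨v', hv', hvv⟩ := hs (show toQuotient H v ∈ _ by simp)
  obtain ⟨w', hw', rfl⟩ := hs (show y ∈ _ by simp)
  obtain ⟨g, hg, rfl⟩ := toQuotient_eq_iff.1 hvv
  have h1 := cubical_of_mem_davisCubes hM hc hv' hw'
  refine ⟨g⁻¹ * w', toQuotient_eq_iff.2 ⟨g⁻¹, H.inv_mem hg, rfl⟩, ?_⟩
  rw [← cubical_mul_left g]
  simpa using h1

/-- If `H` has minimal displacement at least `k ≥ 6`, then the thickening of `H \ Σ` is
`k`-large. -/
theorem isLarge_quotientThickening (hM : M.IsRightAngled) {k : ℕ} (hk6 : 6 ≤ k)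
    (hk : M.nerve.toPreAbstractSimplicialComplex.IsLarge k) {H : Subgroup M.Group}
    (hH : (k : ℕ∞) ≤ M.minDisplacement H) :
    (M.quotientThickening H).toPreAbstractSimplicialComplex.IsLarge k := by
  classical
  rw [AbstractSimplicialComplex.isLarge_iff]
  constructor
  · intro s hs _ hadj
    have hrel : ∀ x ∈ s, ∀ y ∈ s, (M.quotientThickening H).Related x y := by
      intro x hx y hy
      by_cases hxy : x = y
      · exact hxy ▸ (M.quotientThickening H).related_refl x
      · exact (hadj x hx y hy hxy).2
    obtain ⟨y0, hy0⟩ := hs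
    obtain ⟨a, rfl⟩ := toQuotient_surjective H y0
    have hlift : ∀ y ∈ s, ∃ w, toQuotient H w = y ∧ Cubical a w := fun y hy =>
      exists_lift_of_related hM (hrel _ hy0 y hy)
    choose! l hl hal using hlift
    have hll : ∀ y ∈ s, ∀ z ∈ s, Cubical (l y) (l z) := by
      intro y hy z hz
      obtain ⟨b, hb, hyb⟩ := exists_lift_of_related hM (v := l y) (y := z)
        (by rw [hl y hy]; exact hrel y hy z hz)
      obtain ⟨g, hg, rfl⟩ := toQuotient_eq_iff.1 (hb.trans (hl z hz).symm)
      -- The path `l z, a, l y, g (l z)` has three steps, fewer than `k`, so the triangle closes up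
      -- when lifted.
      have hg1 : g = 1 := by
        refine eq_one_of_path hM hH (n := 3) (by omega) hg
          (fun i => if i = 0 then l z else if i = 1 then a else if i = 2 then l y else g * l z)
          ?_ (by simp)
        intro i hi
        interval_cases i
        · simpa using (hal z hz).symm hM
        · simpa using hal y hy
        · simpa using hyb
      simpa [hg1] using hyb
    obtain ⟨c, hc, hsc⟩ := exists_mem_davisCubes_of_cubical hM (P := s.image l)
      ⟨_, Finset.mem_image_of_mem l hy0⟩ (by
        intro v hv w hw
        obtain ⟨y, hy, rfl⟩ := Finset.mem_image.1 hv
        obtain ⟨z, hz, rfl⟩ := Finset.mem_image.1 hw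
        exact hll y hy z hz)
    exact mem_quotientThickening_iff.2 ⟨⟨_, hy0⟩, c, hc, fun y hy =>
      ⟨l y, hsc (Finset.mem_image_of_mem l hy), hl y hy⟩⟩
  · intro n hn c hc
    have h4 := hc.1
    have hsucc : ∀ i, (M.quotientThickening H).Related (c (i % n)) (c ((i + 1) % n)) := by
      intro i
      have hi : i % n < n := Nat.mod_lt _ (by omega)
      rcases Nat.lt_or_ge (i % n + 1) n with h | h
      · have : (i + 1) % n = i % n + 1 := by
          rw [Nat.add_mod, Nat.mod_eq_of_lt (show 1 < n by omega), Nat.mod_eq_of_lt h]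
        rw [this]
        exact (hc.2 _ _ (by omega) h).2 (Or.inl rfl)
      · have h5 : i % n + 1 = n := by omega
        have : (i + 1) % n = 0 := by
          rw [Nat.add_mod, Nat.mod_eq_of_lt (show 1 < n by omega), h5, Nat.mod_self]
        rw [this]
        exact ((hc.2 0 (i % n) (by omega) hi).2 (Or.inr ⟨rfl, by omega⟩)).symm
    obtain ⟨w0, hw0⟩ := toQuotient_surjective H (c 0)
    -- The condition on `v` sits inside the existential so that the chosen successor function is
    -- total; off the path the default is `v`.
    have hstep : ∀ (i : ℕ) (v : M.Group), ∃ w, toQuotient H v = c (i % n) →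
        toQuotient H w = c ((i + 1) % n) ∧ Cubical v w := by
      intro i v
      by_cases hv : toQuotient H v = c (i % n)
      · obtain ⟨w, hw⟩ := exists_lift_of_related hM (v := v) (hv ▸ hsucc i)
        exact ⟨w, fun _ => hw⟩
      · exact ⟨v, fun h => absurd h hv⟩
    choose next hnext using hstep
    let w : ℕ → M.Group := fun i => Nat.rec w0 (fun i v => next i v) i
    have hwq : ∀ i, toQuotient H (w i) = c (i % n) := by
      intro i
      induction i with
      | zero => rw [Nat.zero_mod]; exact hw0
      | succ i ih => exact (hnext i (w i) ih).1
    have hwc : ∀ i, Cubical (w i) (w (i + 1)) := fun i => (hnext i (w i) (hwq i)).2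
    -- The lifted path has `n < k` steps and ends in the `H`-orbit of its start, so it closes up and
    -- is a hole upstairs.
    have hwn : w n = w 0 := by
      obtain ⟨g, hg, hgw⟩ := toQuotient_eq_iff.1
        (show toQuotient H (w n) = toQuotient H (w 0) by rw [hwq, hwq]; simp)
      rw [hgw, eq_one_of_path hM hH hn hg w (fun i _ => hwc i) hgw, one_mul]
    refine not_isHole_cubical hM hk hn w ⟨h4, fun i j hij hj => ⟨fun h => ?_, ?_⟩⟩
    · rw [← hc.2 i j hij hj]
      have := related_quotientThickening hM (H := H) h
      rwa [hwq, hwq, Nat.mod_eq_of_lt hj, Nat.mod_eq_of_lt (hij.trans hj)] at this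
    · rintro (rfl | ⟨rfl, rfl⟩)
      · exact hwc i
      · have := hwc (n - 1)
        rw [show n - 1 + 1 = n by omega, hwn] at this
        exact this.symm hM

theorem finite_quotientVertices (H : Subgroup M.Group) [H.FiniteIndex] :
    Finite (M.quotientVertices H) :=
  Finite.of_equiv _ (QuotientGroup.quotientRightRelEquivQuotientLeftRel H).symm

/-! ### The right-angled Coxeter system of a flag complex -/

/-- Off the diagonal the entries are `2` or `0`, according to whether the pair is an edge of the
nerve. -/
theorem eq_of_nerve_eq {M' : CoxeterMatrix S} (hM : M.IsRightAngled) (hM' : M'.IsRightAngled)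
    (h : M.nerve = M'.nerve) : M = M' := by
  have hj : ∀ s t, M s t ≠ 0 ↔ M' s t ≠ 0 := fun s t =>
    (related_nerve hM).symm.trans (h ▸ related_nerve hM')
  ext s t
  by_cases hst : s = t
  · subst hst
    exact (M.diagonal s).trans (M'.diagonal s).symm
  · have h1 := M.off_diagonal s t hst
    have h2 := M'.off_diagonal s t hst
    have h3 := hj s t
    rcases hM s t with h4 | h4 | h4 <;> rcases hM' s t with h5 | h5 | h5 <;> simp_all

open Classical in
/-- The right-angled Coxeter matrix of the `1`-skeleton of a complex. -/
noncomputable def ofComplex (X : AbstractSimplicialComplex S) : CoxeterMatrix S where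
  M := Matrix.of fun s t => if s = t then 1 else if X.Related s t then 2 else 0
  isSymm := by
    ext s t
    have : X.Related t s ↔ X.Related s t :=
      ⟨AbstractSimplicialComplex.Related.symm, AbstractSimplicialComplex.Related.symm⟩
    simp [this, eq_comm (a := s)]
  diagonal s := by simp
  off_diagonal s t hst := by
    simp only [Matrix.of_apply, hst, if_false]
    split_ifs <;> simp

open Classical in
theorem ofComplex_apply (X : AbstractSimplicialComplex S) (s t : S) :
    ofComplex X s t = if s = t then 1 else if X.Related s t then 2 else 0 := rfl

theorem isRightAngled_ofComplex (X : AbstractSimplicialComplex S) :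
    (ofComplex X).IsRightAngled := by
  intro s t
  rw [ofComplex_apply]
  split_ifs <;> simp

theorem nerve_ofComplex {X : AbstractSimplicialComplex S}
    (hX : X.toPreAbstractSimplicialComplex.IsFlag) : (ofComplex X).nerve = X := by
  classical
  have hj : ∀ s t, ofComplex X s t ≠ 0 ↔ X.Related s t := by
    intro s t
    rw [ofComplex_apply]
    split_ifs with h1 h2
    · simp [h1, X.related_refl]
    · simp [h2]
    · simp [h2]
  have key : ∀ T, T ∈ (ofComplex X).nerve.toPreAbstractSimplicialComplex ↔
      T ∈ X.toPreAbstractSimplicialComplex := by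
    intro T
    rw [mem_nerve_iff (isRightAngled_ofComplex X)]
    constructor
    · rintro ⟨hne, h⟩
      exact hX.mem_of_pairs hne fun s hs t ht => (hj s t).1 (h s hs t ht)
    · intro h
      refine ⟨PreAbstractSimplicialComplex.nonempty_of_mem h, fun s hs t ht => (hj s t).2 ?_⟩
      exact PreAbstractSimplicialComplex.mem_of_subset h
        (by simp [Finset.insert_subset_iff, hs, ht]) ⟨s, by simp⟩
  ext T
  exact key T

end CoxeterMatrix

/-! ### Induction over the basic construction and conclusion -/

/-- Finiteness of the vertex set is carried along because local finiteness and cocompactness of the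
final Davis complex rest on it; it persists since `H` has finite index. -/
theorem BasicConstruction.isLarge {k : ℕ} (hk : 6 ≤ k) {V₀ : Type u} [Finite V₀]
    {X₀ : AbstractSimplicialComplex V₀} (hX₀ : X₀.toPreAbstractSimplicialComplex.IsLarge k)
    {V : Type u} {X : AbstractSimplicialComplex V} (hX : BasicConstruction k X₀ X) :
    Finite V ∧ X.toPreAbstractSimplicialComplex.IsLarge k := by
  induction hX with
  | base => exact ⟨inferInstance, hX₀⟩
  | step _ M hM hnerve H _ _ hdisp ih =>
    subst hnerve
    exact ⟨M.finite_quotientVertices H, M.isLarge_quotientThickening hM hk ih.2 hdisp⟩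

theorem proposition6p1 (k : ℕ) (hk : 6 ≤ k)
    {V₀ : Type u} [Finite V₀] (X₀ : AbstractSimplicialComplex V₀)
    (hX₀ : X₀.toPreAbstractSimplicialComplex.IsLarge k)
    {V : Type u} (X : AbstractSimplicialComplex V) (hX : BasicConstruction k X₀ X) :
    X.toPreAbstractSimplicialComplex.IsLarge k ∧
      (∃! M : CoxeterMatrix V, M.IsRightAngled ∧ M.nerve = X) ∧
      ∀ M : CoxeterMatrix V, M.IsRightAngled → M.nerve = X → IsSystolicGroup k M.Group := by
  obtain ⟨hfin, hlarge⟩ := hX.isLarge hk hX₀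
  refine ⟨hlarge, ⟨CoxeterMatrix.ofComplex X, ⟨CoxeterMatrix.isRightAngled_ofComplex X,
    CoxeterMatrix.nerve_ofComplex hlarge.1⟩, fun M hM => ?_⟩, fun M hM hnerve => ?_⟩
  · exact CoxeterMatrix.eq_of_nerve_eq hM.1 (CoxeterMatrix.isRightAngled_ofComplex X)
      (hM.2.trans (CoxeterMatrix.nerve_ofComplex hlarge.1).symm)
  · exact CoxeterMatrix.isSystolicGroup hM (hnerve ▸ hlarge)
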